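/- **Link diagrams.** An unoriented link diagram in the plane, in general position with respect to the vertical direction, is a finite sequence of slices read from bottom to top, beginning and ending with no strands. Each slice contains one event on neighbouring strands, all other strands being vertical: a creation of two strands (minimum, "cup"), an annihilation of two strands (maximum, "cap"), a crossing $X_+$ (the strand coming from the bottom left passes over) or a crossing $X_-$ (it passes under). *Regular isotopy* is the equivalence relation on link diagrams generated by Reidemeister moves II and III together with isotopy of the plane, that is: exchanging the heights of two events lying side by side, cancelling a minimum against an adjacent maximum of the same strand, and sliding a crossing through a maximum or minimum of one of its strands. **State sum.** Let $F$ be a field, $N\ge 1$, $\mathcal B=(\mathcal B_{ab}^{cd})$ an invertible $N^2\times N^2$ matrix (lower indices: row, incoming states; upper indices: column, outgoing states) and $\mathcal M=(\mathcal M_{ab})$ an invertible $N\times N$ matrix with inverse $\mathcal M^{-1}=(\mathcal M^{ab})$, $a,b,c,d\in\{0,\dots,N-1\}$. The vacuum expectation $\langle K\rangle\in F$ of a link diagram $K$ is the sum, over all labelings of the strands between consecutive slices by $\{0,\dots,N-1\}$ (constant along vertical strands), of the product of the amplitudes of the events: $\mathcal M^{ab}$ for a cup, $\mathcal M_{ab}$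 for a cap, $\mathcal B_{ab}^{cd}$ for $X_+$ and $(\mathcal B^{-1})_{ab}^{cd}$ for $X_-$. **Matrices.** Let $n\ge 1$, $0\ne q\in F$, and fix a fourth root $q^{1/4}\in F$ (so $q^{k/4}=(q^{1/4})^k$). For $N\ge1$, $0\ne\gamma\in F$ and elements $\beta(a,b)$ $(a<b)$ let $\mathcal B$ act on $v_a\otimes v_b\mapsto\sum_{c,d}\mathcal B_{ab}^{cd}v_c\otimes v_d$ as follows. If $a+b\ne N-1$: $$v_a\otimes v_a\mapsto\gamma\, v_a\otimes v_a;\qquad v_a\otimes v_b\mapsto v_b\otimes v_a\ (a>b);\qquad v_a\otimes v_b\mapsto v_b\otimes v_a+(\gamma-\gamma^{-1})v_a\otimes v_b\ (a<b).$$ If $a+b=N-1$: $$v_a\otimes v_{N-1-a}\mapsto \epsilon_a\, v_{N-1-a}\otimes v_a+\sum_{b>a}\beta(a,b)\,v_{N-1-b}\otimes v_b ,$$ with $\epsilon_a=1$ if $2a=N-1$ and $\epsilon_a=\gamma^{-1}$ otherwise. Further let $\mathcal M_{ab}=0$ unless $a+b=N-1$, and $\mathcal M_{a,N-1-a}=t\,\mu_a$,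 where $t\in F\setminus\{0\}$ is an arbitrary normalization constant. The braiding and fusion matrices of the fundamental (vector) representations are given by the following data. The states are ordered by weight; for $D_n$ the two middle weights are numbered $n-1$ and $n$. * $B_n$: $N=2n+1$, $\gamma=q^{-1/2}$, $z=q^{1/2}-q^{-1/2}$; $\mu_a=q^{\frac12(n-a-\frac12)}$ for $a<n$, $\mu_n=1$, $\mu_a=q^{\frac12(n-a+\frac12)}$ for $a>n$; $\beta(a,b)$ equals $z\,q^{-\frac12(a-b)}$ if $(a-n)(b-n)>0$, $z\,q^{-\frac12(a-b+\frac12)}$ if $(a-n)(b-n)=0$, and $z\,q^{-\frac12(a-b+1)}-z\,\delta_{a+b,2n}$ if $(a-n)(b-n)<0$. * $C_n$: $N=2n$, $\gamma=q^{-1/4}$, $z=q^{1/4}-q^{-1/4}$; $\mu_a=-I\,q^{\frac{n-a}4}$ for $a<n$ and $\mu_a=I\,q^{\frac{n-a-1}4}$ for $a\ge n$, where $I\in F$ and $I^2=-1$; $\beta(a,b)$ equals $z\,q^{-\frac14(a-b)}$ if $(a-n+\frac12)(b-n+\frac12)>0$ and $-z\,q^{-\frac14(a-b-1)}-z\,\delta_{a+b,2n-1}$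 otherwise. * $D_n$: $N=2n$, $\gamma=q^{-1/2}$, $z=q^{1/2}-q^{-1/2}$; $\mu_a=q^{\frac{n-a-1}2}$ for $a<n$ and $\mu_a=q^{\frac{n-a}2}$ for $a\ge n$; $\beta(a,b)$ equals $z\,q^{-\frac12(a-b)}$ if $(a-n+\frac12)(b-n+\frac12)>0$ and $z\,q^{-\frac12(a-b+1)}-z\,\delta_{a+b,2n-1}$ otherwise. **Theorem.** Let $\alpha=q^{n}$ for $B_n$, $\alpha=-q^{(2n+1)/4}$ for $C_n$, $\alpha=q^{(2n-1)/2}$ for $D_n$, and assume $z\neq0$ (that is, $q\ne1$ for $B_n$ and $D_n$, and $q^{1/2}\neq1$ for $C_n$). In each of the three cases $\mathcal B$ and $\mathcal M$ are invertible, and the vacuum expectation $D_K=\langle K\rangle$ satisfies the axioms of the Kauffman polynomial with parameters $z$ and $\alpha$: 1. if $K$ and $K'$ are regularly isotopic, then $D_K=D_{K'}$; 2. $D_{L_+}-D_{L_-}=z\,(D_{L_\infty}-D_{L_0})$ whenever $L_+,L_-,L_\infty,L_0$ agree except at one place, where they consist of $X_+$, of $X_-$, of a cap followed by a cup, and of two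 vertical strands, respectively; 3. $D_{\bigcirc}=\dfrac{\alpha-\alpha^{-1}}{z}+1$; and $D_{W_+}=\alpha D_W$, $D_{W_-}=\alpha^{-1}D_W$ whenever $W_\pm$ arises from $W$ by inserting $X_\pm$ on the two strands of a cap directly below it, or on the two strands of a cup directly above it. -/

import Mathlib

namespace LinkSum

/-! ### Link diagrams

An unoriented link diagram in the plane is put in general position with respect to the vertical
(time) direction and read from bottom to top as a sequence of elementary events on a row of
strands: the creation of two neighbouring strands (a minimum), the annihilation of two
neighbouring strands (a maximum), and the two kinds of crossing of two neighbouring strands. -/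

/-- The elementary events. `cross true` is the crossing with amplitude `𝓑`
(the strand that starts on the left passes over), `cross false` is the crossing with
amplitude `𝓑⁻¹` (the strand that starts on the left passes under). -/
inductive Kind where
  | cup : Kind
  | cap : Kind
  | cross : Bool → Kind

/-- Number of strands that enter an event from below. -/
def Kind.inputs : Kind → ℕ
  | .cup => 0
  | .cap => 2
  | .cross _ => 2

/-- Number of strands that leave an event at the top. -/
def Kind.outputs : Kind → ℕ
  | .cup => 2
  | .cap => 0
  | .cross _ => 2

/-- A slice of a diagram: one event, with `pos` vertical strands to the left of it
(and the remaining strands, also vertical, to the right of it). -/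
structure Slice where
  kind : Kind
  pos : ℕ

/-- The creation of two strands to the right of the first `i` strands. -/
def cup (i : ℕ) : Slice := ⟨.cup, i⟩

/-- The annihilation of the strands number `i` and `i + 1` (counted from `0`). -/
def cap (i : ℕ) : Slice := ⟨.cap, i⟩

/-- The crossing of the strands number `i` and `i + 1` (counted from `0`). -/
def cross (e : Bool) (i : ℕ) : Slice := ⟨.cross e, i⟩

/-- `IsTangle m w n`: the slices `w`, stacked from bottom to top, fit together to a
diagram with `m` end points at the bottom and `n` end points at the top. -/
def IsTangle : ℕ → List Slice → ℕ → Prop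
  | m, [], n => m = n
  | m, p :: w, n => p.pos + p.kind.inputs ≤ m ∧ IsTangle (m - p.kind.inputs + p.kind.outputs) w n

/-- A link diagram: a diagram that starts from and ends in the vacuum (no strands). -/
structure LinkDiagram where
  word : List Slice
  closed : IsTangle 0 word 0

/-- The round circle without crossings. -/
def circle : LinkDiagram := ⟨[cup 0, cap 0], by simp [IsTangle, cup, cap, Kind.inputs, Kind.outputs]⟩

/-! ### Regular isotopy -/

/-- The local changes of a diagram in general position with respect to the vertical direction
under an isotopy of the plane. -/
inductive PlanarMove : List Slice → List Slice → Prop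
  /-- Two events that happen side by side may exchange their heights; `k` is the number of
  strands between them. -/
  | exchange (p q : Kind) (i k : ℕ) :
      PlanarMove [⟨p, i⟩, ⟨q, i + p.outputs + k⟩] [⟨q, i + p.inputs + k⟩, ⟨p, i⟩]
  /-- A minimum and a neighbouring maximum of the same strand cancel. -/
  | zigzagRight (i : ℕ) : PlanarMove [cup i, cap (i + 1)] []
  | zigzagLeft (i : ℕ) : PlanarMove [cup (i + 1), cap i] []
  /-- A crossing slides through a maximum or a minimum of one of its two strands. -/
  | slideCap (e : Bool) (i : ℕ) : PlanarMove [cross e i, cap (i + 1)] [cross (!e) (i + 1), cap i]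
  | slideCup (e : Bool) (i : ℕ) : PlanarMove [cup i, cross e (i + 1)] [cup (i + 1), cross (!e) i]

/-- Reidemeister move II. -/
inductive ReidemeisterII : List Slice → List Slice → Prop
  | cancel (e : Bool) (i : ℕ) : ReidemeisterII [cross e i, cross (!e) i] []

/-- Reidemeister move III. The condition on the signs says that the three strands lie one above
the other (the two excluded sign patterns are those in which the first strand passes over
the second, the second over the third, and the third over the first, or the reverse). -/
inductive ReidemeisterIII : List Slice → List Slice → Prop
  | triangle (e₁ e₂ e₃ : Bool) (h : e₁ = e₂ ∨ e₂ = e₃) (i : ℕ) :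
      ReidemeisterIII [cross e₁ i, cross e₂ (i + 1), cross e₃ i]
        [cross e₃ (i + 1), cross e₂ i, cross e₁ (i + 1)]

/-- Two link diagrams differ by one local move. -/
def Step (K K' : LinkDiagram) : Prop :=
  ∃ u x y v : List Slice, (PlanarMove x y ∨ ReidemeisterII x y ∨ ReidemeisterIII x y) ∧
    K.word = u ++ x ++ v ∧ K'.word = u ++ y ++ v

/-- Regular isotopy: the equivalence relation on link diagrams (up to isotopy of the plane)
generated by the Reidemeister moves II and III. -/
def RegularIsotopic : LinkDiagram → LinkDiagram → Prop := Relation.EqvGen Step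

/-! ### The axioms of the Kauffman polynomial -/

/-- The axioms for the Kauffman polynomial (in its Dubrovnik form `D_K(z, α)`) of unoriented links,
with given values of the variables `z` and `α`. -/
structure IsKauffmanPolynomial {F : Type*} [Field F] (z α : F) (D : LinkDiagram → F) : Prop where
  regular_isotopy : ∀ K K' : LinkDiagram, RegularIsotopic K K' → D K = D K'
  /-- `L₊`, `L₋`, `L∞`, `L₀` agree except at one place, where they look like the two crossings,
  a maximum below a minimum, and two vertical strands. -/
  skein : ∀ (u v : List Slice) (i : ℕ) (Lp Lm Linf L0 : LinkDiagram),
    Lp.word = u ++ [cross true i] ++ v → Lm.word = u ++ [cross false i] ++ v →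
    Linf.word = u ++ [cap i, cup i] ++ v → L0.word = u ++ v →
    D Lp - D Lm = z * (D Linf - D L0)
  circle_eq : D circle = (α - α⁻¹) / z + 1
  /-- A curl at a maximum. -/
  curl_cap : ∀ (u v : List Slice) (i : ℕ) (Wp Wm W : LinkDiagram),
    Wp.word = u ++ [cross true i, cap i] ++ v → Wm.word = u ++ [cross false i, cap i] ++ v →
    W.word = u ++ [cap i] ++ v → D Wp = α * D W ∧ D Wm = α⁻¹ * D W
  /-- A curl at a minimum. -/
  curl_cup : ∀ (u v : List Slice) (i : ℕ) (Wp Wm W : LinkDiagram),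
    Wp.word = u ++ [cup i, cross true i] ++ v → Wm.word = u ++ [cup i, cross false i] ++ v →
    W.word = u ++ [cup i] ++ v → D Wp = α * D W ∧ D Wm = α⁻¹ * D W

/-! ### The state sum -/

section StateSum

variable {F ι : Type*} [Field F] [Fintype ι]

/-- The amplitude of the process `w` that starts from the row of states `st` and ends in the
vacuum: the sum over all internal configurations of the products of the amplitudes of the
events. The matrices are indexed with the lower indices (states before the event) as rows and the
upper indices (states after the event) as columns, `B (a, b) (c, d) = 𝓑_{ab}^{cd}`;
`M a b = 𝓜_{ab}` is the amplitude of an annihilation, `M' a b = 𝓜^{ab}` that of a creation. -/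
def amplitude (B B' : Matrix (ι × ι) (ι × ι) F) (M M' : Matrix ι ι F) :
    List Slice → List ι → F
  | [], [] => 1
  | [], _ :: _ => 0
  | p :: w, st =>
    match p.kind, st.drop p.pos with
    | .cup, r => ∑ a, ∑ b, M' a b * amplitude B B' M M' w (st.take p.pos ++ a :: b :: r)
    | .cap, a :: b :: r => M a b * amplitude B B' M M' w (st.take p.pos ++ r)
    | .cross e, a :: b :: r =>
        ∑ c, ∑ d, (bif e then B (a, b) (c, d) else B' (a, b) (c, d)) *
          amplitude B B' M M' w (st.take p.pos ++ c :: d :: r)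
    | _, _ => 0

/-- The vacuum expectation `⟨K⟩` built from the braiding matrix `B`, its inverse, the fusion
matrix `M` and its inverse. -/
noncomputable def vacuumExpectation [DecidableEq ι] (B : Matrix (ι × ι) (ι × ι) F)
    (M : Matrix ι ι F) (K : LinkDiagram) : F :=
  amplitude B B⁻¹ M M⁻¹ K.word []

end StateSum

/-! ### The braiding and fusion matrices

The states `v_0, …, v_{N-1}` are the weight vectors of the fundamental representation in their
order; `v_a` and `v_b` are complementary if `a + b = N - 1`. Here `N = 2n + 1` for `B_n` and
`N = 2n` for `C_n` and `D_n`; for `D_n` a state is named by its order `o(a)`. Throughout,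
`s = q^{1/4}`. -/

section Matrices

variable {F : Type*} [Field F]

/-- The common shape of the braiding matrices. On `v_a ⊗ v_b` with `a`, `b` not complementary:
`v_a ⊗ v_a ↦ γ v_a ⊗ v_a`, `v_a ⊗ v_b ↦ v_b ⊗ v_a` if `a > b`, and
`v_a ⊗ v_b ↦ v_b ⊗ v_a + (γ - γ⁻¹) v_a ⊗ v_b` if `a < b`. If `a`, `b` are complementary, the
coefficient of a complementary pair `v_c ⊗ v_d` is `0` if `d < a`, it is `γ⁻¹` if `d = a`
(but `1` if `d = a = b = c`), and it is `β a d` if `a < d`. -/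
def braiding (N : ℕ) (γ : F) (β : ℕ → ℕ → F) :
    Matrix (Fin N × Fin N) (Fin N × Fin N) F :=
  Matrix.of fun (ab cd : Fin N × Fin N) =>
    let a := ab.1.val
    let b := ab.2.val
    let c := cd.1.val
    let d := cd.2.val
    if a + b + 1 ≠ N then
      if a = b then (if c = a ∧ d = b then γ else 0)
      else if c = b ∧ d = a then 1
      else if a < b ∧ c = a ∧ d = b then γ - γ⁻¹
      else 0
    else if c + d + 1 ≠ N then 0
    else if d < a then 0
    else if d = a then (if a = b then 1 else γ⁻¹)
    else β a d

/-- The antidiagonal matrix with the entry `μ a` in row `a`. -/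
def antidiagonal (N : ℕ) (μ : ℕ → F) : Matrix (Fin N) (Fin N) F :=
  Matrix.of fun a b => if a.val + b.val + 1 = N then μ a.val else 0

/-- The coefficients `β_{a,2n-a}^{2n-b,b}`, `a < b`, for `B_n`. -/
def betaB (n : ℕ) (s : F) (a b : ℕ) : F :=
  let x : ℤ := ((a : ℤ) - n) * ((b : ℤ) - n)
  if 0 < x then (s ^ 2 - (s ^ 2)⁻¹) * s ^ (-2 * ((a : ℤ) - b))
  else if x = 0 then (s ^ 2 - (s ^ 2)⁻¹) * s ^ (-2 * ((a : ℤ) - b) - 1)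
  else (s ^ 2 - (s ^ 2)⁻¹) * s ^ (-2 * ((a : ℤ) - b + 1)) +
    (if a + b = 2 * n then (s ^ 2)⁻¹ - s ^ 2 else 0)

/-- The braiding matrix of `B_n`. -/
def braidingB (n : ℕ) (s : F) :
    Matrix (Fin (2 * n + 1) × Fin (2 * n + 1)) (Fin (2 * n + 1) × Fin (2 * n + 1)) F :=
  braiding (2 * n + 1) (s ^ 2)⁻¹ (betaB n s)

/-- The fusion matrix of `B_n`: `𝓜_{a,2n-a}` is `q^{(n-a-1/2)/2}` for `a < n`, `1` for `a = n`, and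
`q^{(n-a+1/2)/2}` for `a > n`. -/
def fusionB (n : ℕ) (s : F) : Matrix (Fin (2 * n + 1)) (Fin (2 * n + 1)) F :=
  antidiagonal (2 * n + 1) fun a =>
    if a < n then s ^ (2 * ((n : ℤ) - a) - 1)
    else if a = n then 1
    else s ^ (2 * ((n : ℤ) - a) + 1)

/-- The coefficients `β_{a,2n-1-a}^{2n-1-b,b}`, `a < b`, for `C_n`. -/
def betaC (n : ℕ) (s : F) (a b : ℕ) : F :=
  if 0 < (2 * (a : ℤ) - 2 * n + 1) * (2 * (b : ℤ) - 2 * n + 1) then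
    (s - s⁻¹) * s ^ (-((a : ℤ) - b))
  else (s⁻¹ - s) * s ^ (-((a : ℤ) - b - 1)) + (if a + b + 1 = 2 * n then s⁻¹ - s else 0)

/-- The braiding matrix of `C_n`. -/
def braidingC (n : ℕ) (s : F) :
    Matrix (Fin (2 * n) × Fin (2 * n)) (Fin (2 * n) × Fin (2 * n)) F :=
  braiding (2 * n) s⁻¹ (betaC n s)

/-- The fusion matrix of `C_n`, where `I` is a square root of `-1`: `𝓜_{a,2n-1-a}` is
`-I q^{(n-a)/4}` for `a < n` and `I q^{(n-a-1)/4}` for `a ≥ n`. -/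
def fusionC (n : ℕ) (I s : F) : Matrix (Fin (2 * n)) (Fin (2 * n)) F :=
  antidiagonal (2 * n) fun a =>
    if a < n then -I * s ^ ((n : ℤ) - a) else I * s ^ ((n : ℤ) - a - 1)

/-- The coefficients `β_{a,2n-1-a}^{2n-1-b,b}`, `a < b`, for `D_n` (states named by their order). -/
def betaD (n : ℕ) (s : F) (a b : ℕ) : F :=
  if 0 < (2 * (a : ℤ) - 2 * n + 1) * (2 * (b : ℤ) - 2 * n + 1) then
    (s ^ 2 - (s ^ 2)⁻¹) * s ^ (-2 * ((a : ℤ) - b))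
  else (s ^ 2 - (s ^ 2)⁻¹) * s ^ (-2 * ((a : ℤ) - b + 1)) +
    (if a + b + 1 = 2 * n then (s ^ 2)⁻¹ - s ^ 2 else 0)

/-- The braiding matrix of `D_n`. -/
def braidingD (n : ℕ) (s : F) :
    Matrix (Fin (2 * n) × Fin (2 * n)) (Fin (2 * n) × Fin (2 * n)) F :=
  braiding (2 * n) (s ^ 2)⁻¹ (betaD n s)

/-- The fusion matrix of `D_n`: `𝓜_{a,2n-1-a}` is `q^{(n-a-1)/2}` for `a < n` and `q^{(n-a)/2}` for
`a ≥ n`. -/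
def fusionD (n : ℕ) (s : F) : Matrix (Fin (2 * n)) (Fin (2 * n)) F :=
  antidiagonal (2 * n) fun a =>
    if a < n then s ^ (2 * ((n : ℤ) - a - 1)) else s ^ (2 * ((n : ℤ) - a))

end Matrices

end LinkSum

namespace LinkSum

/-! ### The state sum as a composition of linear operators -/

/-! Each slice acts linearly on functions of the row of states, so a vacuum expectation is a value
of a composite of local operators. A local change of the diagram therefore has the required effect
as soon as the corresponding relation holds for the local amplitudes. These relations form
`IsLinkModel`, and `IsLinkModel.isKauffmanPolynomial` deduces the axioms from them.

The three series are treated together by giving the states integer labels, opposite for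
complementary states. The matrices then depend only on `γ` and on nonzero weights `m`. For arbitrary
such weights, a rotation by a right angle exchanges `braidMatrix` and `invMatrix`, and their
difference is `γ⁻¹ - γ` times (cap-cup minus identity). The one real condition on the weights is
that the curl at a maximum has the same value `α` in every state. Differences of these curl
equations are telescoping sums, which give that the two matrices are inverse to each other
(`braidMatrix_mul_invMatrix`). Comparing the curls at the lowest and at the highest label gives the
value of the circle.

The braid relation is proved by rotation and induction. Let the defect be the difference of its two
sides. Rotating the six end points by one step leaves one crossing of the wrong sign; the skein
relation corrects it, and the extra terms cancel. So the defects of the matrix and of its inverse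
are exchanged up to a factor (`braidDefect_rotate`). In suitable positions an extreme label passes
freely through every other state, which kills the defect; by rotation it vanishes whenever any outer
state is extreme. If none is, no inner state is extreme either, and the extreme labels can be
dropped (`braidDefect_restrict`).

For each series it remains to compare the curls of neighbouring labels, an identity between powers
of `s = q^{1/4}`. -/

lemma exists_split {ι : Type*} (st : List ι) (i j : ℕ) (h : i + j ≤ st.length) :
    ∃ l x r : List ι, l.length = i ∧ x.length = j ∧ st = l ++ (x ++ r) :=
  ⟨st.take i, (st.drop i).take j, (st.drop i).drop j, by simp; omega, by simp; omega, by simp⟩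

section Operators

variable {F ι : Type*} [Field F] [Fintype ι]
variable (R : Bool → Matrix (ι × ι) (ι × ι) F) (M M' : Matrix ι ι F)

/-- The action of an event on functions of the states of the strands that take part in it. -/
def kindOp : Kind → (List ι → F) → List ι → F
  | .cup, g, [] => ∑ a, ∑ b, M' a b * g [a, b]
  | .cap, g, [a, b] => M a b * g []
  | .cross e, g, [a, b] => ∑ c, ∑ d, R e (a, b) (c, d) * g [c, d]
  | _, _, _ => 0

lemma kindOp_add (p : Kind) (g h : List ι → F) (x : List ι) :
    kindOp R M M' p (fun y => g y + h y) x = kindOp R M M' p g x + kindOp R M M' p h x := by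
  unfold kindOp
  split <;> simp [mul_add, Finset.sum_add_distrib]

lemma kindOp_mul (p : Kind) (c : F) (g : List ι → F) (x : List ι) :
    kindOp R M M' p (fun y => c * g y) x = c * kindOp R M M' p g x := by
  unfold kindOp
  split <;> simp [mul_left_comm, Finset.mul_sum]

lemma kindOp_cup (g : List ι → F) :
    kindOp R M M' .cup g [] = ∑ a, ∑ b, M' a b * g [a, b] := rfl

lemma kindOp_cap (g : List ι → F) (a b : ι) :
    kindOp R M M' .cap g [a, b] = M a b * g [] := rfl

lemma kindOp_cross (e : Bool) (g : List ι → F) (a b : ι) :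
    kindOp R M M' (.cross e) g [a, b] = ∑ c, ∑ d, R e (a, b) (c, d) * g [c, d] := rfl

lemma kindOp_of_length_ne (p : Kind) (g : List ι → F) (x : List ι) (hx : x.length ≠ p.inputs) :
    kindOp R M M' p g x = 0 := by
  unfold kindOp
  split <;> simp [Kind.inputs] at hx ⊢

/-- An event evaluates its argument only on rows as long as its output. This lets inductions over a
diagram keep track of the number of strands. -/
lemma kindOp_congr (p : Kind) (g h : List ι → F) (x : List ι)
    (H : ∀ y : List ι, y.length = p.outputs → g y = h y) :
    kindOp R M M' p g x = kindOp R M M' p h x := by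
  by_cases hx : x.length = p.inputs
  · rcases p with _ | _ | e
    · obtain rfl := List.length_eq_zero_iff.1 hx
      simp [kindOp_cup, show ∀ a b, g [a, b] = h [a, b] from fun a b => H _ rfl]
    · obtain ⟨a, b, rfl⟩ := List.length_eq_two.1 hx
      rw [kindOp_cap, kindOp_cap, H [] rfl]
    · obtain ⟨a, b, rfl⟩ := List.length_eq_two.1 hx
      simp [kindOp_cross, show ∀ a b, g [a, b] = h [a, b] from fun a b => H _ rfl]
  · simp [kindOp_of_length_ne, hx]

lemma kindOp_zero (p : Kind) (x : List ι) : kindOp R M M' p (fun _ => 0) x = 0 := by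
  unfold kindOp
  split <;> simp

lemma kindOp_sum {κ : Type*} (s : Finset κ) (p : Kind) (g : κ → List ι → F) (x : List ι) :
    kindOp R M M' p (fun y => ∑ k ∈ s, g k y) x = ∑ k ∈ s, kindOp R M M' p (g k) x := by
  classical
  induction s using Finset.induction_on with
  | empty => simp [kindOp_zero]
  | insert a s ha ih => simp [Finset.sum_insert ha, kindOp_add, ih]

/-- Each event is a finite linear combination of evaluations, so two of them acting on separate
variables commute. This is the algebra behind exchanging the heights of distant events. -/
lemma kindOp_comm (p q : Kind) (G : List ι → List ι → F) (x x' : List ι) :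
    kindOp R M M' p (fun y => kindOp R M M' q (fun y' => G y y') x') x =
      kindOp R M M' q (fun y' => kindOp R M M' p (fun y => G y y') x) x' := by
  by_cases hx : x'.length = q.inputs
  · rcases q with _ | _ | e
    · obtain rfl := List.length_eq_zero_iff.1 hx
      simp [kindOp_cup, kindOp_sum, kindOp_mul]
    · obtain ⟨a, b, rfl⟩ := List.length_eq_two.1 hx
      simp [kindOp_cap, kindOp_mul]
    · obtain ⟨a, b, rfl⟩ := List.length_eq_two.1 hx
      simp [kindOp_cross, kindOp_sum, kindOp_mul]
  · simp [kindOp_of_length_ne, hx, kindOp_zero]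

/-- The action of a slice on functions of the row of states. -/
def sliceOp (p : Slice) : (List ι → F) →ₗ[F] (List ι → F) where
  toFun f st := if p.pos + p.kind.inputs ≤ st.length then
      kindOp R M M' p.kind
        (fun y => f (st.take p.pos ++ (y ++ st.drop (p.pos + p.kind.inputs))))
        ((st.drop p.pos).take p.kind.inputs)
    else 0
  map_add' f g := by
    ext st
    by_cases h : p.pos + p.kind.inputs ≤ st.length <;> simp [h, kindOp_add]
  map_smul' c f := by
    ext st
    by_cases h : p.pos + p.kind.inputs ≤ st.length <;> simp [h, kindOp_mul]

lemma sliceOp_apply (p : Kind) (i : ℕ) (f : List ι → F) (l x r : List ι) (hl : l.length = i)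
    (hx : x.length = p.inputs) :
    sliceOp R M M' ⟨p, i⟩ f (l ++ (x ++ r)) = kindOp R M M' p (fun y => f (l ++ (y ++ r))) x := by
  subst hl
  simp [sliceOp, ← hx]

/-- The action of a diagram: the last slice acts first. -/
def wordOp : List Slice → (List ι → F) →ₗ[F] (List ι → F)
  | [] => LinearMap.id
  | p :: w => sliceOp R M M' p ∘ₗ wordOp w

lemma wordOp_append (u v : List Slice) :
    wordOp R M M' (u ++ v) = wordOp R M M' u ∘ₗ wordOp R M M' v := by
  induction u with
  | nil => rfl
  | cons p u ih => simp [wordOp, ih, LinearMap.comp_assoc]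

/-- The function that singles out the row without strands. -/
def vacuum : List ι → F
  | [] => 1
  | _ :: _ => 0

end Operators

/-- The tangle hypothesis is essential: for a cup placed beyond the end of the row, `amplitude`
still inserts two states while `sliceOp` returns zero. -/
lemma amplitude_eq_wordOp {F ι : Type*} [Field F] [Fintype ι]
    (B B' : Matrix (ι × ι) (ι × ι) F) (M M' : Matrix ι ι F) (m n : ℕ) (w : List Slice)
    (hw : IsTangle m w n) (st : List ι) (hst : st.length = m) :
    amplitude B B' M M' w st =
      wordOp (fun e => bif e then B else B') M M' w vacuum st := by
  induction w generalizing st m with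
  | nil => cases st <;> simp [amplitude, wordOp, vacuum]
  | cons p w ih =>
    obtain ⟨k, i⟩ := p
    obtain ⟨h, hw⟩ := hw
    obtain ⟨l, x, r, rfl, hx, rfl⟩ := exists_split st i k.inputs (by simpa [hst] using h)
    simp only [wordOp, LinearMap.comp_apply]
    rw [sliceOp_apply _ _ _ _ _ _ _ _ _ rfl hx]
    simp only [List.length_append] at hst
    rw [kindOp_congr _ _ _ _ _ (fun y => amplitude B B' M M' w (l ++ (y ++ r))) x]
    · rcases k with _ | _ | e
      · obtain rfl := List.length_eq_zero_iff.1 hx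
        simp [amplitude, kindOp]
      · obtain ⟨a, b, rfl⟩ := List.length_eq_two.1 hx
        simp [amplitude, kindOp]
      · obtain ⟨a, b, rfl⟩ := List.length_eq_two.1 hx
        cases e <;> simp [amplitude, kindOp]
    · intro y hy
      refine (ih _ hw _ ?_).symm
      simp only [List.length_append, hy]
      dsimp only at *
      omega

lemma isTangle_append (m n : ℕ) (u v : List Slice) :
    IsTangle m (u ++ v) n ↔ ∃ k, IsTangle m u k ∧ IsTangle k v n := by
  induction u generalizing m with
  | nil => simp [IsTangle]
  | cons p u ih => simp [IsTangle, ih, and_assoc]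

/-! ### Locality: operators of tangles and the action of single slices -/

section LocalChange

variable {F ι : Type*} [Field F] [Fintype ι]
variable (R : Bool → Matrix (ι × ι) (ι × ι) F) (M M' : Matrix ι ι F)

/-- The part `u` of a diagram sees what lies above it only through rows with the right number of
strands. Local relations fail on rows that are too short, so this restriction is what makes them
usable; by linearity it yields the congruence lemmas below. -/
lemma wordOp_eq_zero (m n : ℕ) (u : List Slice) (hu : IsTangle m u n) (f : List ι → F)
    (hf : ∀ st, st.length = n → f st = 0) (st : List ι) (hst : st.length = m) :
    wordOp R M M' u f st = 0 := by
  induction u generalizing st m with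
  | nil => exact hf _ (hst.trans hu)
  | cons p w ih =>
    obtain ⟨k, i⟩ := p
    obtain ⟨h, hw⟩ := hu
    obtain ⟨l, x, r, rfl, hx, rfl⟩ := exists_split st i k.inputs (by simpa [hst] using h)
    simp only [wordOp, LinearMap.comp_apply]
    rw [sliceOp_apply _ _ _ _ _ _ _ _ _ rfl hx, kindOp_congr _ _ _ _ _ (fun _ => 0) x,
      kindOp_zero]
    intro y hy
    refine ih _ hw _ ?_
    simp only [List.length_append, hy] at *
    omega

lemma wordOp_congr (m n : ℕ) (u : List Slice) (hu : IsTangle m u n) (f g : List ι → F)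
    (hf : ∀ st, st.length = n → f st = g st) (st : List ι) (hst : st.length = m) :
    wordOp R M M' u f st = wordOp R M M' u g st := by
  have := wordOp_eq_zero R M M' m n u hu (f - g) (fun st h => by simp [hf st h]) st hst
  rwa [map_sub, Pi.sub_apply, sub_eq_zero] at this

lemma wordOp_congr_mul (m n : ℕ) (u : List Slice) (hu : IsTangle m u n) (c : F) (f g : List ι → F)
    (hf : ∀ st, st.length = n → f st = c * g st) (st : List ι) (hst : st.length = m) :
    wordOp R M M' u f st = c * wordOp R M M' u g st := by
  rw [wordOp_congr R M M' m n u hu f (c • g) hf st hst, map_smul, Pi.smul_apply, smul_eq_mul]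

lemma wordOp_congr_skein (m n : ℕ) (u : List Slice) (hu : IsTangle m u n) (z : F)
    (f f' g g' : List ι → F)
    (hf : ∀ st, st.length = n → f st - f' st = z * (g st - g' st)) (st : List ι)
    (hst : st.length = m) :
    wordOp R M M' u f st - wordOp R M M' u f' st =
      z * (wordOp R M M' u g st - wordOp R M M' u g' st) := by
  have := wordOp_congr_mul R M M' m n u hu z (f - f') (g - g') hf st hst
  simpa only [map_sub, Pi.sub_apply] using this

lemma sliceOp_cup (i : ℕ) (f : List ι → F) (l r : List ι) (hl : l.length = i) :
    sliceOp R M M' (cup i) f (l ++ r) = ∑ a, ∑ b, M' a b * f (l ++ a :: b :: r) := by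
  simpa [kindOp, cup] using sliceOp_apply R M M' .cup i f l [] r hl rfl

lemma sliceOp_cap (i : ℕ) (f : List ι → F) (l r : List ι) (a b : ι) (hl : l.length = i) :
    sliceOp R M M' (cap i) f (l ++ a :: b :: r) = M a b * f (l ++ r) := by
  simpa [kindOp, cap] using sliceOp_apply R M M' .cap i f l [a, b] r hl rfl

lemma sliceOp_cross (e : Bool) (i : ℕ) (f : List ι → F) (l r : List ι) (a b : ι)
    (hl : l.length = i) :
    sliceOp R M M' (cross e i) f (l ++ a :: b :: r) =
      ∑ c, ∑ d, R e (a, b) (c, d) * f (l ++ c :: d :: r) := by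
  simpa [kindOp, cross] using sliceOp_apply R M M' (.cross e) i f l [a, b] r hl rfl

lemma sliceOp_cup_succ (i : ℕ) (f : List ι → F) (l r : List ι) (x : ι) (hl : l.length = i) :
    sliceOp R M M' (cup (i + 1)) f (l ++ x :: r) =
      ∑ a, ∑ b, M' a b * f (l ++ x :: a :: b :: r) := by
  simpa using sliceOp_cup R M M' (i + 1) f (l ++ [x]) r (by simp [hl])

lemma sliceOp_cap_succ (i : ℕ) (f : List ι → F) (l r : List ι) (x a b : ι) (hl : l.length = i) :
    sliceOp R M M' (cap (i + 1)) f (l ++ x :: a :: b :: r) = M a b * f (l ++ x :: r) := by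
  simpa using sliceOp_cap R M M' (i + 1) f (l ++ [x]) r a b (by simp [hl])

lemma sliceOp_cross_succ (e : Bool) (i : ℕ) (f : List ι → F) (l r : List ι) (x a b : ι)
    (hl : l.length = i) :
    sliceOp R M M' (cross e (i + 1)) f (l ++ x :: a :: b :: r) =
      ∑ c, ∑ d, R e (a, b) (c, d) * f (l ++ x :: c :: d :: r) := by
  simpa using sliceOp_cross R M M' e (i + 1) f (l ++ [x]) r a b (by simp [hl])

/-- Events side by side commute. -/
lemma wordOp_exchange (p q : Kind) (i k m n : ℕ) (f : List ι → F) (st : List ι)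
    (hst : st.length = m)
    (h : IsTangle m [⟨p, i⟩, ⟨q, i + p.outputs + k⟩] n) :
    wordOp R M M' [⟨p, i⟩, ⟨q, i + p.outputs + k⟩] f st =
      wordOp R M M' [⟨q, i + p.inputs + k⟩, ⟨p, i⟩] f st := by
  obtain ⟨h1, h2, -⟩ := h
  dsimp only at h1 h2
  obtain ⟨l, x, r, hl, hx, rfl⟩ := exists_split st i p.inputs (hst ▸ h1)
  simp only [List.length_append] at hst
  obtain ⟨t, x', r, ht, hx', rfl⟩ := exists_split r k q.inputs (by omega)
  simp only [wordOp, LinearMap.comp_apply, LinearMap.id_apply]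
  rw [sliceOp_apply R M M' p i _ l x _ hl hx]
  rw [kindOp_congr R M M' p _ (fun y => kindOp R M M' q (fun y' =>
    f (l ++ (y ++ (t ++ (y' ++ r))))) x') x]
  · rw [kindOp_comm]
    have := sliceOp_apply R M M' q (i + p.inputs + k) (sliceOp R M M' ⟨p, i⟩ f) (l ++ (x ++ t)) x' r
      (by simp; omega) hx'
    simp only [List.append_assoc] at this
    rw [this]
    congr 1
    funext y'
    rw [sliceOp_apply R M M' p i _ l x _ hl hx]
  · intro y hy
    have := sliceOp_apply R M M' q (i + p.outputs + k) f (l ++ (y ++ t)) x' r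
      (by simp; omega) hx'
    simpa only [List.append_assoc] using this

end LocalChange

/-! ### Operators on three strands -/

section ThreeStrands

open scoped Kronecker

variable {F ι : Type*} [Field F] [DecidableEq ι]

/-- A matrix on two strands, acting on the first two of three strands. -/
def leftOf (A : Matrix (ι × ι) (ι × ι) F) : Matrix (ι × ι × ι) (ι × ι × ι) F :=
  (A ⊗ₖ (1 : Matrix ι ι F)).submatrix (Equiv.prodAssoc ι ι ι).symm (Equiv.prodAssoc ι ι ι).symm

/-- A matrix on two strands, acting on the last two of three strands. -/
def rightOf (A : Matrix (ι × ι) (ι × ι) F) : Matrix (ι × ι × ι) (ι × ι × ι) F :=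
  (1 : Matrix ι ι F) ⊗ₖ A

lemma leftOf_apply (A : Matrix (ι × ι) (ι × ι) F) (a b c d e f : ι) :
    leftOf A (a, b, c) (d, e, f) = if c = f then A (a, b) (d, e) else 0 := by
  simp [leftOf, Matrix.one_apply]

lemma rightOf_apply (A : Matrix (ι × ι) (ι × ι) F) (a b c d e f : ι) :
    rightOf A (a, b, c) (d, e, f) = if a = d then A (b, c) (e, f) else 0 := by
  simp [rightOf, Matrix.one_apply]

lemma leftOf_one : leftOf (1 : Matrix (ι × ι) (ι × ι) F) = 1 := by
  simp [leftOf]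

lemma rightOf_one : rightOf (1 : Matrix (ι × ι) (ι × ι) F) = 1 := by
  simp [rightOf]

lemma leftOf_add (A B : Matrix (ι × ι) (ι × ι) F) : leftOf (A + B) = leftOf A + leftOf B := by
  ext ⟨a, b, c⟩ ⟨d, e, f⟩
  simp only [leftOf_apply, Matrix.add_apply]
  split_ifs <;> simp

lemma rightOf_add (A B : Matrix (ι × ι) (ι × ι) F) : rightOf (A + B) = rightOf A + rightOf B := by
  simp [rightOf, Matrix.kronecker_add]

lemma leftOf_smul (r : F) (A : Matrix (ι × ι) (ι × ι) F) : leftOf (r • A) = r • leftOf A := by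
  ext ⟨a, b, c⟩ ⟨d, e, f⟩
  simp [leftOf_apply]

lemma rightOf_smul (r : F) (A : Matrix (ι × ι) (ι × ι) F) : rightOf (r • A) = r • rightOf A := by
  simp [rightOf, Matrix.kronecker_smul]

variable [Fintype ι]

lemma leftOf_mul (A B : Matrix (ι × ι) (ι × ι) F) : leftOf (A * B) = leftOf A * leftOf B := by
  simp only [leftOf, Matrix.submatrix_mul_equiv]
  rw [← Matrix.mul_kronecker_mul, one_mul]

lemma rightOf_mul (A B : Matrix (ι × ι) (ι × ι) F) : rightOf (A * B) = rightOf A * rightOf B := by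
  simp only [rightOf]
  rw [← Matrix.mul_kronecker_mul, one_mul]

lemma leftOf_mulVec (A : Matrix (ι × ι) (ι × ι) F) (g : ι × ι × ι → F) (a b c : ι) :
    (leftOf A).mulVec g (a, b, c) = ∑ d, ∑ e, A (a, b) (d, e) * g (d, e, c) := by
  simp [Matrix.mulVec, dotProduct, Fintype.sum_prod_type, leftOf_apply]

lemma rightOf_mulVec (A : Matrix (ι × ι) (ι × ι) F) (g : ι × ι × ι → F) (a b c : ι) :
    (rightOf A).mulVec g (a, b, c) = ∑ d, ∑ e, A (b, c) (d, e) * g (a, d, e) := by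
  simp only [Matrix.mulVec, dotProduct, Fintype.sum_prod_type, rightOf_apply]
  rw [Finset.sum_eq_single a] <;> simp +contextual [eq_comm]

/-- The mixed braid relations follow from the positive one. -/
lemma braid_relation_signs (x y : Bool → Matrix (ι × ι × ι) (ι × ι × ι) F)
    (hx : ∀ e, x e * x (!e) = 1) (hy : ∀ e, y e * y (!e) = 1)
    (h : x true * y true * x true = y true * x true * y true)
    (e₁ e₂ e₃ : Bool) (he : e₁ = e₂ ∨ e₂ = e₃) :
    x e₁ * y e₂ * x e₃ = y e₃ * x e₂ * y e₁ := by
  let X : (Matrix (ι × ι × ι) (ι × ι × ι) F)ˣ := ⟨x true, x false, hx true, hx false⟩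
  let Y : (Matrix (ι × ι × ι) (ι × ι × ι) F)ˣ := ⟨y true, y false, hy true, hy false⟩
  have H : X * Y * X = Y * X * Y := Units.ext h
  have key : ∀ {G : Type _} [Group G] (u v : G), u * v * u = v * u * v →
      u * v * u⁻¹ = v⁻¹ * u * v ∧ u⁻¹ * v * u = v * u * v⁻¹ := by
    intro G _ u v huv
    constructor
    · rw [mul_inv_eq_iff_eq_mul, mul_assoc, mul_assoc, eq_inv_mul_iff_mul_eq]
      simpa [mul_assoc] using huv.symm
    · rw [eq_mul_inv_iff_mul_eq, mul_assoc, mul_assoc, inv_mul_eq_iff_eq_mul]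
      simpa [mul_assoc] using huv.symm
  have Hinv : X⁻¹ * Y⁻¹ * X⁻¹ = Y⁻¹ * X⁻¹ * Y⁻¹ := by
    have := congrArg (·⁻¹) H
    simpa [mul_assoc] using this
  have h1 := key X Y H
  have h2 := key X⁻¹ Y⁻¹ Hinv
  simp only [inv_inv] at h2
  rcases e₁ <;> rcases e₂ <;> rcases e₃ <;> simp only [reduceCtorEq, or_self] at he
  exacts [congrArg Units.val Hinv, congrArg Units.val h2.1, congrArg Units.val h1.2,
    congrArg Units.val h2.2, congrArg Units.val h1.1, h]

end ThreeStrands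

/-! ### Local relations imply the axioms -/

section Axioms

variable {F ι : Type*} [Field F] [Fintype ι] [DecidableEq ι]

/-- The local relations between the amplitudes that make the state sum a specialization of the
Kauffman polynomial. -/
structure IsLinkModel (z α : F) (R : Bool → Matrix (ι × ι) (ι × ι) F) (M M' : Matrix ι ι F) :
    Prop where
  cancel : ∀ e, R e * R (!e) = 1
  braid : leftOf (R true) * rightOf (R true) * leftOf (R true) =
    rightOf (R true) * leftOf (R true) * rightOf (R true)
  fusion : M * M' = 1
  slideCap : ∀ e a b c d, ∑ w, R e (a, b) (d, w) * M w c = ∑ w, R (!e) (b, c) (w, d) * M a w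
  slideCup : ∀ e a b c d, ∑ w, M' a w * R e (w, b) (c, d) = ∑ w, M' w d * R (!e) (b, w) (a, c)
  skein : ∀ a b c d, R true (a, b) (c, d) - R false (a, b) (c, d) =
    z * (M a b * M' c d - if a = c ∧ b = d then 1 else 0)
  circle : ∑ a, ∑ b, M' a b * M a b = (α - α⁻¹) / z + 1
  curlCap : ∀ e a b, ∑ c, ∑ d, R e (a, b) (c, d) * M c d = (bif e then α else α⁻¹) * M a b
  curlCup : ∀ e c d, ∑ a, ∑ b, M' a b * R e (a, b) (c, d) = (bif e then α else α⁻¹) * M' c d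

namespace IsLinkModel

variable {z α : F} {R : Bool → Matrix (ι × ι) (ι × ι) F} {M M' : Matrix ι ι F}

lemma planarMove (H : IsLinkModel z α R M M') {x y : List Slice} (hxy : PlanarMove x y) (m n : ℕ)
    (hx : IsTangle m x n) (f : List ι → F) (st : List ι) (hst : st.length = m) :
    wordOp R M M' x f st = wordOp R M M' y f st := by
  have hM : ∀ a c, ∑ b, M a b * M' b c = if a = c then 1 else 0 := fun a c => by
    rw [← Matrix.mul_apply, H.fusion, Matrix.one_apply]
  have hM' : ∀ a c, ∑ b, M' a b * M b c = if a = c then 1 else 0 := fun a c => by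
    rw [← Matrix.mul_apply, mul_eq_one_comm.1 H.fusion, Matrix.one_apply]
  cases hxy with
  | exchange p q i k => exact wordOp_exchange R M M' p q i k m n f st hst hx
  | zigzagRight i =>
    simp only [IsTangle, cup, cap, Kind.inputs, Kind.outputs] at hx
    obtain ⟨l, x, r, hl, hx, rfl⟩ := exists_split st i 1 (by omega)
    obtain ⟨x, rfl⟩ := List.length_eq_one_iff.1 hx
    simp only [wordOp, LinearMap.comp_apply, LinearMap.id_apply, List.cons_append, List.nil_append]
    simp only [sliceOp_cup R M M' i _ l _ hl, sliceOp_cap_succ R M M' i _ l _ _ _ _ hl,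
      ← mul_assoc, ← Finset.sum_mul, hM']
    simp
  | zigzagLeft i =>
    simp only [IsTangle, cup, cap, Kind.inputs, Kind.outputs] at hx
    obtain ⟨l, x, r, hl, hx, rfl⟩ := exists_split st i 1 (by omega)
    obtain ⟨x, rfl⟩ := List.length_eq_one_iff.1 hx
    simp only [wordOp, LinearMap.comp_apply, LinearMap.id_apply, List.cons_append, List.nil_append]
    simp only [sliceOp_cup_succ R M M' i _ l _ _ hl, sliceOp_cap R M M' i _ l _ _ _ hl]
    rw [Finset.sum_comm]
    simp only [← mul_assoc, mul_comm (M' _ _) (M _ _), ← Finset.sum_mul, hM]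
    simp
  | slideCap e i =>
    simp only [IsTangle, cross, cap, Kind.inputs, Kind.outputs] at hx
    obtain ⟨l, x, r, hl, hx, rfl⟩ := exists_split st i 3 (by omega)
    obtain ⟨a, b, c, rfl⟩ := List.length_eq_three.1 hx
    simp only [wordOp, LinearMap.comp_apply, LinearMap.id_apply, List.cons_append, List.nil_append]
    simp only [sliceOp_cross R M M' _ i _ l _ _ _ hl, sliceOp_cap_succ R M M' i _ l _ _ _ _ hl,
      sliceOp_cross_succ R M M' _ i _ l _ _ _ _ hl, sliceOp_cap R M M' i _ l _ _ _ hl]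
    rw [Finset.sum_comm (γ := ι) (f := fun c_1 d => R (!e) (b, c) (c_1, d) * _)]
    simp only [← mul_assoc, ← Finset.sum_mul, H.slideCap]
  | slideCup e i =>
    simp only [IsTangle, cross, cup, Kind.inputs, Kind.outputs] at hx
    obtain ⟨l, x, r, hl, hx, rfl⟩ := exists_split st i 1 (by omega)
    obtain ⟨x, rfl⟩ := List.length_eq_one_iff.1 hx
    simp only [wordOp, LinearMap.comp_apply, LinearMap.id_apply, List.cons_append, List.nil_append]
    simp only [sliceOp_cross R M M' _ i _ l _ _ _ hl, sliceOp_cup_succ R M M' i _ l _ _ hl,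
      sliceOp_cross_succ R M M' _ i _ l _ _ _ _ hl, sliceOp_cup R M M' i _ l _ hl,
      Finset.mul_sum, ← mul_assoc]
    -- On both sides one internal state `w` is contracted. Moving its sum innermost exposes the two
    -- sides of `H.slideCup`.
    have h1 : ∀ g : ι → ι → ι → F,
        ∑ a, ∑ w, ∑ c, ∑ d, M' a w * R e (w, x) (c, d) * g a c d =
          ∑ a, ∑ c, ∑ d, (∑ w, M' a w * R e (w, x) (c, d)) * g a c d := by
      intro g
      refine Finset.sum_congr rfl fun a _ => ?_
      rw [Finset.sum_comm]
      refine Finset.sum_congr rfl fun c _ => ?_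
      rw [Finset.sum_comm]
      simp only [Finset.sum_mul]
    have h2 : ∀ g : ι → ι → ι → F,
        ∑ w, ∑ d, ∑ a, ∑ c, M' w d * R (!e) (x, w) (a, c) * g a c d =
          ∑ a, ∑ c, ∑ d, (∑ w, M' w d * R (!e) (x, w) (a, c)) * g a c d := by
      intro g
      simp only [Finset.sum_mul]
      simp only [← Fintype.sum_prod_type']
      refine Fintype.sum_equiv ⟨fun p => (p.2.2.1, p.2.2.2, p.2.1, p.1),
        fun p => (p.2.2.2, p.2.2.1, p.1, p.2.1), fun _ => rfl, fun _ => rfl⟩ _ _ fun _ => rfl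
    rw [h1 fun a c d => f (l ++ a :: c :: d :: r), h2 fun a c d => f (l ++ a :: c :: d :: r)]
    simp only [H.slideCup]

lemma sum_cancel (H : IsLinkModel z α R M M') (e : Bool) (a b : ι) (g : ι → ι → F) :
    ∑ c, ∑ d, R e (a, b) (c, d) * ∑ c', ∑ d', R (!e) (c, d) (c', d') * g c' d' = g a b := by
  have h := congrArg (fun A => A.mulVec (fun p : ι × ι => g p.1 p.2) (a, b)) (H.cancel e)
  simp only [← Matrix.mulVec_mulVec] at h
  rw [Matrix.one_mulVec] at h
  simpa [Matrix.mulVec, dotProduct, Fintype.sum_prod_type] using h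

lemma reidemeisterII (H : IsLinkModel z α R M M') {x y : List Slice} (hxy : ReidemeisterII x y)
    (m n : ℕ) (hx : IsTangle m x n) (f : List ι → F) (st : List ι) (hst : st.length = m) :
    wordOp R M M' x f st = wordOp R M M' y f st := by
  cases hxy with
  | cancel e i =>
    simp only [IsTangle, cross, Kind.inputs, Kind.outputs] at hx
    obtain ⟨l, x, r, hl, hx, rfl⟩ := exists_split st i 2 (by omega)
    obtain ⟨a, b, rfl⟩ := List.length_eq_two.1 hx
    simp only [wordOp, LinearMap.comp_apply, LinearMap.id_apply, List.cons_append, List.nil_append]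
    simp only [sliceOp_cross R M M' _ i _ l _ _ _ hl]
    exact H.sum_cancel e a b fun c d => f (l ++ c :: d :: r)

lemma reidemeisterIII (H : IsLinkModel z α R M M') {x y : List Slice} (hxy : ReidemeisterIII x y)
    (m n : ℕ) (hx : IsTangle m x n) (f : List ι → F) (st : List ι) (hst : st.length = m) :
    wordOp R M M' x f st = wordOp R M M' y f st := by
  cases hxy with
  | triangle e₁ e₂ e₃ h i =>
    simp only [IsTangle, cross, Kind.inputs, Kind.outputs] at hx
    obtain ⟨l, x, r, hl, hx, rfl⟩ := exists_split st i 3 (by omega)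
    obtain ⟨a, b, c, rfl⟩ := List.length_eq_three.1 hx
    simp only [wordOp, LinearMap.comp_apply, LinearMap.id_apply, List.cons_append, List.nil_append]
    simp only [sliceOp_cross R M M' _ i _ l _ _ _ hl, sliceOp_cross_succ R M M' _ i _ l _ _ _ _ hl]
    have key := braid_relation_signs (fun e => leftOf (R e)) (fun e => rightOf (R e))
      (fun e => by rw [← leftOf_mul, H.cancel, leftOf_one])
      (fun e => by rw [← rightOf_mul, H.cancel, rightOf_one]) H.braid e₁ e₂ e₃ h
    have := congrArg (fun A => A.mulVec (fun p : ι × ι × ι =>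
      f (l ++ p.1 :: p.2.1 :: p.2.2 :: r)) (a, b, c)) key
    simpa only [← Matrix.mulVec_mulVec, leftOf_mulVec, rightOf_mulVec] using this

/-- The slices `v` above the change give an arbitrary function, and the slices `u` below it are a
tangle ending in `k` strands. The local relation is thus needed only on rows of length `k`, where
the changed part fits. -/
lemma step_eq (H : IsLinkModel z α R M M') {K K' : LinkDiagram} (h : Step K K') :
    wordOp R M M' K.word vacuum [] = wordOp R M M' K'.word vacuum [] := by
  obtain ⟨u, x, y, v, hxy, hK, hK'⟩ := h
  have hc := K.closed
  rw [hK, List.append_assoc] at hc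
  rw [hK, hK', List.append_assoc, List.append_assoc, wordOp_append R M M' u,
    wordOp_append R M M' u, wordOp_append R M M' x, wordOp_append R M M' y]
  obtain ⟨k, hu, hc⟩ := (isTangle_append _ _ _ _).1 hc
  obtain ⟨k', hx, -⟩ := (isTangle_append _ _ _ _).1 hc
  refine wordOp_congr R M M' 0 k u hu _ _ (fun st hst => ?_) [] rfl
  rcases hxy with h | h | h
  · exact H.planarMove h _ _ hx _ st hst
  · exact H.reidemeisterII h _ _ hx _ st hst
  · exact H.reidemeisterIII h _ _ hx _ st hst

lemma curl_cap (H : IsLinkModel z α R M M') (e : Bool) (u v : List Slice) (i : ℕ)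
    (W' W : LinkDiagram) (hW' : W'.word = u ++ [cross e i, cap i] ++ v)
    (hW : W.word = u ++ [cap i] ++ v) :
    wordOp R M M' W'.word vacuum [] =
      (bif e then α else α⁻¹) * wordOp R M M' W.word vacuum [] := by
  have hc := W.closed
  rw [hW, List.append_assoc] at hc
  rw [hW, hW', List.append_assoc, List.append_assoc, wordOp_append R M M' u,
    wordOp_append R M M' u, wordOp_append R M M' [cap i], wordOp_append R M M' [cross e i, cap i],
    LinearMap.comp_apply, LinearMap.comp_apply]
  obtain ⟨k, hu, hc⟩ := (isTangle_append _ _ _ _).1 hc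
  refine wordOp_congr_mul R M M' 0 k u hu _ _ _ (fun st hst => ?_) [] rfl
  simp only [List.cons_append, List.nil_append, IsTangle, cap, Kind.inputs] at hc
  obtain ⟨l, x, r, hl, hx, rfl⟩ := exists_split st i 2 (by omega)
  obtain ⟨a, b, rfl⟩ := List.length_eq_two.1 hx
  simp only [wordOp, LinearMap.comp_apply, List.cons_append, List.nil_append,
    LinearMap.id_apply]
  simp only [sliceOp_cross R M M' _ i _ l _ _ _ hl, sliceOp_cap R M M' i _ l _ _ _ hl,
    ← mul_assoc, ← Finset.sum_mul, H.curlCap]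

lemma curl_cup (H : IsLinkModel z α R M M') (e : Bool) (u v : List Slice) (i : ℕ)
    (W' W : LinkDiagram) (hW' : W'.word = u ++ [cup i, cross e i] ++ v)
    (hW : W.word = u ++ [cup i] ++ v) :
    wordOp R M M' W'.word vacuum [] =
      (bif e then α else α⁻¹) * wordOp R M M' W.word vacuum [] := by
  have hc := W.closed
  rw [hW, List.append_assoc] at hc
  rw [hW, hW', List.append_assoc, List.append_assoc, wordOp_append R M M' u,
    wordOp_append R M M' u, wordOp_append R M M' [cup i], wordOp_append R M M' [cup i, cross e i],
    LinearMap.comp_apply, LinearMap.comp_apply]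
  obtain ⟨k, hu, hc⟩ := (isTangle_append _ _ _ _).1 hc
  refine wordOp_congr_mul R M M' 0 k u hu _ _ _ (fun st hst => ?_) [] rfl
  simp only [List.cons_append, List.nil_append, IsTangle, cup, Kind.inputs] at hc
  obtain ⟨l, x, r, hl, hx, rfl⟩ := exists_split st i 0 (by omega)
  obtain rfl := List.length_eq_zero_iff.1 hx
  simp only [wordOp, LinearMap.comp_apply, List.nil_append,
    LinearMap.id_apply]
  simp only [sliceOp_cross R M M' _ i _ l _ _ _ hl, sliceOp_cup R M M' i _ l _ hl]
  have h : ∀ g : ι → ι → F, ∑ a, ∑ b, M' a b * ∑ c, ∑ d, R e (a, b) (c, d) * g c d =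
      ∑ c, ∑ d, (∑ a, ∑ b, M' a b * R e (a, b) (c, d)) * g c d := by
    intro g
    simp only [Finset.mul_sum, Finset.sum_mul, ← Fintype.sum_prod_type', ← mul_assoc]
    exact Fintype.sum_equiv ⟨fun p => (p.2.2.1, p.2.2.2, p.1, p.2.1),
        fun p => (p.2.2.1, p.2.2.2, p.1, p.2.1), fun _ => rfl, fun _ => rfl⟩ _ _ fun _ => rfl
  rw [h fun c d => wordOp R M M' v vacuum (l ++ c :: d :: r)]
  simp only [H.curlCup, Finset.mul_sum, mul_assoc]

lemma skein_relation (H : IsLinkModel z α R M M') (u v : List Slice) (i : ℕ)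
    (Lp Lm Linf L0 : LinkDiagram)
    (hp : Lp.word = u ++ [cross true i] ++ v) (hm : Lm.word = u ++ [cross false i] ++ v)
    (hinf : Linf.word = u ++ [cap i, cup i] ++ v) (h0 : L0.word = u ++ v) :
    wordOp R M M' Lp.word vacuum [] - wordOp R M M' Lm.word vacuum [] =
      z * (wordOp R M M' Linf.word vacuum [] - wordOp R M M' L0.word vacuum []) := by
  have hc := Lp.closed
  rw [hp, List.append_assoc] at hc
  rw [hp, hm, hinf, h0, List.append_assoc, List.append_assoc, List.append_assoc]
  iterate 4 rw [wordOp_append R M M' u]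
  rw [wordOp_append R M M' [cross true i], wordOp_append R M M' [cross false i],
    wordOp_append R M M' [cap i, cup i]]
  simp only [LinearMap.comp_apply]
  obtain ⟨k, hu, hc⟩ := (isTangle_append _ _ _ _).1 hc
  refine wordOp_congr_skein R M M' 0 k u hu _ _ _ _ _ (fun st hst => ?_) [] rfl
  simp only [List.cons_append, List.nil_append, IsTangle, cross, Kind.inputs] at hc
  obtain ⟨l, x, r, hl, hx, rfl⟩ := exists_split st i 2 (by omega)
  obtain ⟨a, b, rfl⟩ := List.length_eq_two.1 hx
  simp only [wordOp, LinearMap.comp_apply, LinearMap.id_apply, List.cons_append, List.nil_append]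
  simp only [sliceOp_cross R M M' _ i _ l _ _ _ hl, sliceOp_cap R M M' i _ l _ _ _ hl,
    sliceOp_cup R M M' i _ l _ hl]
  generalize wordOp R M M' v vacuum = g
  rw [← Finset.sum_sub_distrib]
  simp only [← Finset.sum_sub_distrib, ← sub_mul, H.skein]
  simp only [mul_sub, sub_mul, Finset.sum_sub_distrib, Finset.mul_sum, mul_assoc]
  congr 1
  rw [Finset.sum_eq_single a (by simp +contextual [eq_comm]) (by simp),
    Finset.sum_eq_single b (by simp +contextual [eq_comm]) (by simp)]
  simp

/-- The state sum built from the solution of the local relations satisfies the axioms of the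
Kauffman polynomial. -/
theorem isKauffmanPolynomial {B B' : Matrix (ι × ι) (ι × ι) F}
    (H : IsLinkModel z α (fun e => bif e then B else B') M M') :
    IsKauffmanPolynomial z α (vacuumExpectation B M) := by
  have hB : B⁻¹ = B' := Matrix.inv_eq_right_inv (H.cancel true)
  have hM : M⁻¹ = M' := Matrix.inv_eq_right_inv H.fusion
  have hD : ∀ K : LinkDiagram, vacuumExpectation B M K =
      wordOp (fun e => bif e then B else B') M M' K.word vacuum [] := fun K => by
    rw [vacuumExpectation, hB, hM, amplitude_eq_wordOp B B' M M' 0 0 K.word K.closed [] rfl]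
  refine ⟨?_, ?_, ?_, ?_, ?_⟩
  · intro K K' h
    induction h with
    | rel _ _ h => rw [hD, hD, H.step_eq h]
    | refl => rfl
    | symm _ _ _ ih => exact ih.symm
    | trans _ _ _ _ _ ih ih' => exact ih.trans ih'
  · intro u v i Lp Lm Linf L0 hp hm hinf h0
    simpa only [hD] using H.skein_relation u v i Lp Lm Linf L0 hp hm hinf h0
  · rw [← H.circle, hD]
    simp only [LinkSum.circle, wordOp, LinearMap.comp_apply, LinearMap.id_apply]
    refine (sliceOp_cup _ M M' 0 _ [] [] rfl).trans ?_
    refine Finset.sum_congr rfl fun a _ => Finset.sum_congr rfl fun b _ => ?_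
    refine congrArg (M' a b * ·) ((sliceOp_cap _ M M' 0 _ [] [] a b rfl).trans ?_)
    exact mul_one _
  · intro u v i Wp Wm W hp hm hW
    simp only [hD]
    exact ⟨H.curl_cap true u v i Wp W hp hW, H.curl_cap false u v i Wm W hm hW⟩
  · intro u v i Wp Wm W hp hm hW
    simp only [hD]
    exact ⟨H.curl_cup true u v i Wp W hp hW, H.curl_cup false u v i Wm W hm hW⟩

end IsLinkModel

end Axioms

/-! ### The entries of the braiding matrices

The states are labelled by integers in such a way that complementary states have opposite labels. -/

section Entries

variable {F : Type*} [Field F]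

/-- The amplitude of the transposition of the states `a` and `b`. -/
def coupling (γ : F) (a b : ℤ) : F :=
  if a = b then (if a = 0 then 1 else γ) else if a + b = 0 then γ⁻¹ else 1

/-- The amplitude of a crossing in terms of labels. -/
def braidEntry (γ : F) (m : ℤ → F) (a b c d : ℤ) : F :=
  (if c = b ∧ d = a then coupling γ a b else 0) -
    (if a < b ∧ c = a ∧ d = b then γ⁻¹ - γ else 0) +
    (if a + b = 0 ∧ c + d = 0 ∧ a < d then (γ⁻¹ - γ) * (m a / m d) else 0)

/-- The amplitude of the inverse crossing in terms of labels. -/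
def invEntry (γ : F) (m : ℤ → F) (a b c d : ℤ) : F :=
  (if c = b ∧ d = a then coupling γ a b else 0) +
    (if b ≤ a ∧ c = a ∧ d = b then γ⁻¹ - γ else 0) -
    (if a + b = 0 ∧ c + d = 0 ∧ d ≤ a then (γ⁻¹ - γ) * (m a / m d) else 0)

variable (γ : F) (m : ℤ → F)

lemma coupling_comm (a b : ℤ) : coupling γ a b = coupling γ b a := by
  unfold coupling; grind

/-- The coupling to a fixed label `k` acts as a multiplicative charge: complementary pairs have
trivial total charge, so replacing one such pair by another conserves it. -/
lemma coupling_mul_coupling_neg (hγ : γ ≠ 0) (a b k : ℤ) (h : a + b = 0) :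
    coupling γ a k * coupling γ b k = 1 := by
  unfold coupling; grind

lemma braidEntry_sub_invEntry (a b c d : ℤ) :
    braidEntry γ m a b c d - invEntry γ m a b c d =
      (γ⁻¹ - γ) * ((if a + b = 0 ∧ c + d = 0 then m a / m d else 0) -
        if a = c ∧ b = d then 1 else 0) := by
  unfold braidEntry invEntry; grind

/-- A right angle turn preserves the transposition term and exchanges the diagonal term with the
pair term. The inequalities are strict in one matrix and weak in the other because the boundary
cases turn the coupling `γ⁻¹` into `γ` or back. -/
lemma invEntry_eq_rotate (hm : ∀ i, m i ≠ 0) (a b c d : ℤ) :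
    invEntry γ m a b c d = braidEntry γ m (-c) a d (-b) * (m (-b) / m (-c)) := by
  have := hm (-b)
  have := hm (-c)
  unfold braidEntry invEntry coupling; grind (splits := 20)

lemma braidEntry_eq_rotate (hm : ∀ i, m i ≠ 0) (a b c d : ℤ) :
    braidEntry γ m a b c d = invEntry γ m (-c) a d (-b) * (m (-b) / m (-c)) := by
  have := hm (-b)
  have := hm (-c)
  unfold braidEntry invEntry coupling; grind (splits := 20)

lemma braidEntry_support (a b c d : ℤ) (h : braidEntry γ m a b c d ≠ 0) :
    (c = b ∧ d = a) ∨ (a < b ∧ c = a ∧ d = b) ∨ (a + b = 0 ∧ c + d = 0 ∧ a < d) := by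
  unfold braidEntry at h; grind

lemma invEntry_support (a b c d : ℤ) (h : invEntry γ m a b c d ≠ 0) :
    (c = b ∧ d = a) ∨ (c = a ∧ d = b) ∨ (a + b = 0 ∧ c + d = 0) := by
  unfold invEntry at h; grind

/-- The diagonal term would need a label below `k`, the pair term one above `-k`; only the
transposition survives. -/
lemma braidEntry_lowest_right (k x w f : ℤ) (hx : k ≤ x ∧ x ≤ -k) (hf : k ≤ f ∧ f ≤ -k) :
    braidEntry γ m x k w f = if w = k ∧ f = x then coupling γ x k else 0 := by
  unfold braidEntry; grind

lemma braidEntry_highest_left (k x w f : ℤ) (hx : -k ≤ x ∧ x ≤ k) (hf : -k ≤ f ∧ f ≤ k) :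
    braidEntry γ m k x w f = if w = x ∧ f = k then coupling γ x k else 0 := by
  rw [coupling_comm γ x k]
  unfold braidEntry; grind

/-- The weak inequalities leave boundary terms. For `k ≠ 0` they change the coupling: `γ + (γ⁻¹ - γ)
= γ⁻¹` when `x = k`, and `γ⁻¹ - (γ⁻¹ - γ) = γ` when `x = -k`. Hence `γ` is replaced by `γ⁻¹`. -/
lemma invEntry_lowest_left (hm : ∀ i, m i ≠ 0) (k x w f : ℤ) (hx : k ≤ x ∧ x ≤ -k)
    (hf : k ≤ f ∧ f ≤ -k) :
    invEntry γ m k x w f = if w = x ∧ f = k then coupling γ⁻¹ x k else 0 := by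
  have := hm k
  unfold invEntry coupling; grind (splits := 20)

lemma invEntry_highest_right (hm : ∀ i, m i ≠ 0) (k x w f : ℤ)
    (hx : -k ≤ x ∧ x ≤ k) (hf : -k ≤ f ∧ f ≤ k) :
    invEntry γ m x k w f = if w = k ∧ f = x then coupling γ⁻¹ x k else 0 := by
  have := hm x
  unfold invEntry coupling; grind (splits := 20)

/-- Hecke relation: the case of states that are not complementary. -/
lemma braidEntry_cancel (hγ : γ ≠ 0) (a b c d : ℤ) (h : a + b ≠ 0) :
    coupling γ a b * invEntry γ m b a c d -
      (if a < b then (γ⁻¹ - γ) * invEntry γ m a b c d else 0) =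
      if a = c ∧ b = d then 1 else 0 := by
  unfold invEntry coupling; grind (splits := 20)

end Entries

/-! ### Rotation of the braid relation -/

section Rotation

variable {F ι : Type*} [Field F] [Fintype ι] [DecidableEq ι]

lemma leftOf_mul_rightOf_apply (A B : Matrix (ι × ι) (ι × ι) F) (a b c d e f : ι) :
    (leftOf A * rightOf B) (a, b, c) (d, e, f) = ∑ w, A (a, b) (d, w) * B (w, c) (e, f) := by
  simp only [Matrix.mul_apply, Fintype.sum_prod_type, leftOf_apply, rightOf_apply]
  rw [Finset.sum_eq_single d (fun x _ hx => by simp [hx]) (by simp)]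
  simp

lemma rightOf_mul_leftOf_apply (A B : Matrix (ι × ι) (ι × ι) F) (a b c d e f : ι) :
    (rightOf A * leftOf B) (a, b, c) (d, e, f) = ∑ w, A (b, c) (w, f) * B (a, w) (d, e) := by
  simp only [Matrix.mul_apply, Fintype.sum_prod_type, leftOf_apply, rightOf_apply]
  rw [Finset.sum_eq_single a (fun x _ hx => by simp [hx.symm]) (by simp)]
  simp

lemma left_right_left_apply (A B C : Matrix (ι × ι) (ι × ι) F) (a b c d e f : ι) :
    (leftOf A * rightOf B * leftOf C) (a, b, c) (d, e, f) =
      ∑ x, ∑ y, ∑ w, A (a, b) (x, y) * B (y, c) (w, f) * C (x, w) (d, e) := by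
  rw [Matrix.mul_assoc, Matrix.mul_apply]
  simp only [Fintype.sum_prod_type, leftOf_apply, rightOf_mul_leftOf_apply]
  simp [Finset.mul_sum, mul_assoc]

lemma right_left_right_apply (A B C : Matrix (ι × ι) (ι × ι) F) (a b c d e f : ι) :
    (rightOf A * leftOf B * rightOf C) (a, b, c) (d, e, f) =
      ∑ x, ∑ y, ∑ w, A (b, c) (x, y) * B (a, x) (d, w) * C (w, y) (e, f) := by
  rw [Matrix.mul_assoc, Matrix.mul_apply]
  simp only [Fintype.sum_prod_type, rightOf_apply, leftOf_mul_rightOf_apply]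
  rw [Finset.sum_eq_single a (fun x _ hx => by simp [hx.symm]) (by simp)]
  simp [Finset.mul_sum, mul_assoc]

/-- The difference of the two sides of the braid relation. -/
def braidDefect (B : Matrix (ι × ι) (ι × ι) F) : Matrix (ι × ι × ι) (ι × ι × ι) F :=
  leftOf B * rightOf B * leftOf B - rightOf B * leftOf B * rightOf B

/-- A maximum followed by a minimum. -/
def capCup (rv : ι → ι) (μ : ι → F) : Matrix (ι × ι) (ι × ι) F :=
  Matrix.of fun p q => if p.2 = rv p.1 ∧ q.1 = rv q.2 then μ p.1 / μ q.2 else 0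

/-- Two mutually inverse matrices that are exchanged by a rotation by a right angle, and that
satisfy a skein relation. -/
structure IsRotationPair (rv : ι → ι) (μ : ι → F) (z : F) (B B' : Matrix (ι × ι) (ι × ι) F) :
    Prop where
  involutive : ∀ a, rv (rv a) = a
  ne_zero : ∀ a, μ a ≠ 0
  cancel : B * B' = 1
  rotate : ∀ a b c d, B (a, b) (c, d) = B' (rv c, a) (d, rv b) * (μ (rv b) / μ (rv c))
  rotate' : ∀ a b c d, B' (a, b) (c, d) = B (rv c, a) (d, rv b) * (μ (rv b) / μ (rv c))
  skein : B = B' + z • (capCup rv μ + (-1 : F) • 1)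

namespace IsRotationPair

variable {rv : ι → ι} {μ : ι → F} {z : F} {B B' : Matrix (ι × ι) (ι × ι) F}

lemma symm (H : IsRotationPair rv μ z B B') : IsRotationPair rv μ (-z) B' B where
  involutive := H.involutive
  ne_zero := H.ne_zero
  cancel := mul_eq_one_comm.1 H.cancel
  rotate := H.rotate'
  rotate' := H.rotate
  skein := by rw [neg_smul, ← sub_eq_add_neg, eq_sub_iff_add_eq]; exact H.skein.symm

lemma sum_cancel (H : IsRotationPair rv μ z B B') (a b c d : ι) :
    ∑ x, ∑ y, B (a, b) (x, y) * B' (x, y) (c, d) = if a = c ∧ b = d then 1 else 0 := by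
  have := congrArg (fun A => A (a, b) (c, d)) H.cancel
  simpa [Matrix.mul_apply, Fintype.sum_prod_type, Matrix.one_apply] using this

/-- Two crossings pass through a minimum, or through a maximum. -/
lemma capCup_slide (H : IsRotationPair rv μ z B B') :
    rightOf (capCup rv μ) * (leftOf B * rightOf B) =
      leftOf B * rightOf B * leftOf (capCup rv μ) := by
  have hr : ∀ a b, a = rv b ↔ b = rv a := fun a b =>
    ⟨fun h => by rw [h, H.involutive], fun h => by rw [h, H.involutive]⟩
  ext ⟨a, b, c⟩ ⟨d, e, f⟩
  have h1 : (rightOf (capCup rv μ) * (leftOf B * rightOf B)) (a, b, c) (d, e, f) =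
      if c = rv b then if rv d = e ∧ a = f then μ b / μ (rv d) else 0 else 0 := by
    rw [← Matrix.mul_assoc, right_left_right_apply]
    by_cases hc : c = rv b
    · rw [if_pos hc]
      -- The cap-cup joins the two crossings along one strand; rotating one of them turns the
      -- product into `B' * B`, which cancels.
      have : ∀ x y w, capCup rv μ (b, c) (x, y) * B (a, x) (d, w) * B (w, y) (e, f) =
          if x = rv y then
            μ b / μ (rv d) * (B' (rv d, a) (w, y) * B (w, y) (e, f)) else 0 := by
        intro x y w
        simp only [capCup, Matrix.of_apply, hc, true_and]
        split_ifs with hx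
        · rw [H.rotate a x d w, hx, H.involutive]
          have := H.ne_zero y
          field_simp
        · simp
      simp only [this]
      rw [Finset.sum_comm]
      rw [show (∑ y, ∑ x, ∑ w, if x = rv y then
          μ b / μ (rv d) * (B' (rv d, a) (w, y) * B (w, y) (e, f)) else 0) =
          μ b / μ (rv d) * ∑ w, ∑ y, B' (rv d, a) (w, y) * B (w, y) (e, f) from ?_,
        H.symm.sum_cancel]
      · simp
      · rw [Finset.sum_comm (f := fun w y => B' (rv d, a) (w, y) * B (w, y) (e, f)),
          Finset.mul_sum]
        refine Finset.sum_congr rfl fun y _ => ?_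
        rw [Finset.sum_comm]
        simp [Finset.mul_sum]
    · simp [capCup, hc]
  have h2 : (leftOf B * rightOf B * leftOf (capCup rv μ)) (a, b, c) (d, e, f) =
      if d = rv e then if a = f ∧ b = rv c then μ (rv c) / μ e else 0 else 0 := by
    rw [left_right_left_apply]
    by_cases hd : d = rv e
    · rw [if_pos hd]
      have : ∀ x y w, B (a, b) (x, y) * B (y, c) (w, f) * capCup rv μ (x, w) (d, e) =
          if w = rv x then
            μ (rv c) / μ e * (B (a, b) (x, y) * B' (x, y) (f, rv c)) else 0 := by
        intro x y w
        simp only [capCup, Matrix.of_apply, hd, and_true]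
        split_ifs with hx
        · rw [H.rotate y c w f, hx, H.involutive]
          have := H.ne_zero x
          field_simp
        · simp
      simp only [this]
      simp only [Finset.sum_ite_eq', Finset.mem_univ, if_true, ← Finset.mul_sum]
      simp [H.sum_cancel]
    · simp [capCup, hd]
  rw [h1, h2]
  have := hr d e
  have := hr b c
  grind

/-- Rotation by one step exchanges the defects of `B` and of `B'`, up to a factor. -/
lemma braidDefect_rotate (H : IsRotationPair rv μ z B B') (a b c d e f : ι) :
    braidDefect B (a, b, c) (d, e, f) =
      -(μ (rv c) / μ (rv d)) * braidDefect B' (rv d, a, b) (e, f, rv c) := by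
  let eq : ι ≃ ι := ⟨rv, rv, H.involutive, H.involutive⟩
  have h1 : (leftOf B * rightOf B * leftOf B) (a, b, c) (d, e, f) =
      μ (rv c) / μ (rv d) *
        (rightOf B * leftOf B' * rightOf B') (rv d, a, b) (e, f, rv c) := by
    rw [left_right_left_apply, right_left_right_apply]
    simp only [Finset.mul_sum]
    refine Finset.sum_congr rfl fun x _ => Finset.sum_congr rfl fun y _ => ?_
    refine Fintype.sum_equiv eq _ _ fun w => ?_
    change _ = μ (rv c) / μ (rv d) * (_ * B' (rv d, x) (e, rv w) * B' (rv w, y) (f, rv c))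
    rw [H.rotate y c w f, H.rotate x w d e]
    have := H.ne_zero (rv w)
    field_simp
  have h2 : (rightOf B * leftOf B * rightOf B) (a, b, c) (d, e, f) =
      μ (rv c) / μ (rv d) *
        (leftOf B' * rightOf B' * leftOf B) (rv d, a, b) (e, f, rv c) := by
    rw [left_right_left_apply, right_left_right_apply]
    simp only [Finset.mul_sum, ← Fintype.sum_prod_type']
    refine Fintype.sum_equiv ⟨fun p => (p.2.2, rv p.1, p.2.1), fun p => (rv p.2.1, p.2.2, p.1),
      fun p => by simp [H.involutive], fun p => by simp [H.involutive]⟩ _ _ fun ⟨x, y, w⟩ => ?_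
    change _ = μ (rv c) / μ (rv d) * (B' (rv d, a) (w, rv x) * B' (rv x, b) (y, rv c) *
      B (w, y) (e, f))
    rw [H.rotate b c x y, H.rotate a x d w]
    have := H.ne_zero (rv x)
    field_simp
  -- One crossing in each product still has the wrong sign. The skein relation replaces it by `B'`;
  -- the cap-cup terms cancel by `capCup_slide`, and the identity terms are equal.
  have h3 : rightOf B * leftOf B' * rightOf B' - leftOf B' * rightOf B' * leftOf B =
      -braidDefect B' := by
    have hs := H.symm.capCup_slide
    rw [H.skein, leftOf_add, rightOf_add, leftOf_smul, rightOf_smul, leftOf_add, rightOf_add,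
      leftOf_smul, rightOf_smul, leftOf_one, rightOf_one, braidDefect]
    simp only [add_mul, mul_add, smul_mul_assoc, mul_smul_comm, smul_add, one_mul, mul_one,
      Matrix.mul_assoc] at hs ⊢
    rw [hs]
    abel
  rw [braidDefect, Matrix.sub_apply, h1, h2, ← mul_sub, ← Matrix.sub_apply, h3, Matrix.neg_apply,
    mul_neg, neg_mul]

end IsRotationPair

/-- If the state `k` moves freely from the right to the left, then the braid relation holds on
triples of states that end in `k`. -/
lemma braidDefect_free_right (A : Matrix (ι × ι) (ι × ι) F) (k : ι) (χ : ι → F)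
    (hA : ∀ x w f, A (x, k) (w, f) = if w = k ∧ f = x then χ x else 0)
    (hχ : ∀ a b c d, A (a, b) (c, d) ≠ 0 → χ a * χ b = χ c * χ d) (a b d e f : ι) :
    braidDefect A (a, b, k) (d, e, f) = 0 := by
  rw [braidDefect, Matrix.sub_apply, left_right_left_apply, right_left_right_apply]
  simp only [hA]
  -- Here `k` passes the other two strands after they have crossed, in `h2` before. The collected
  -- factors `χ` agree because the crossing conserves their product.
  have h1 : ∑ x, ∑ y, ∑ w, A (a, b) (x, y) * (if w = k ∧ f = y then χ y else 0) *
      A (x, w) (d, e) = if d = k then A (a, b) (e, f) * (χ e * χ f) else 0 := by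
    rw [Finset.sum_eq_single e, Finset.sum_eq_single f, Finset.sum_eq_single k]
    · rw [hA]; split_ifs <;> simp_all; ring
    · intro w _ hw; simp [hw]
    · simp
    · intro y _ hy; simp [hy.symm]
    · simp
    · intro x _ hx
      refine Finset.sum_eq_zero fun y _ => Finset.sum_eq_zero fun w _ => ?_
      by_cases hw : w = k
      · rw [hw, hA]; simp [hx.symm]
      · simp [hw]
    · simp
  have h2 : ∑ x, ∑ y, ∑ w, (if x = k ∧ y = b then χ b else 0) * A (a, x) (d, w) *
      A (w, y) (e, f) = if d = k then A (a, b) (e, f) * (χ a * χ b) else 0 := by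
    rw [Finset.sum_eq_single k, Finset.sum_eq_single b, Finset.sum_eq_single a]
    · rw [hA]; split_ifs <;> simp_all; ring
    · intro w _ hw; rw [hA]; simp [hw]
    · simp
    · intro y _ hy; simp [hy]
    · simp
    · intro x _ hx; simp [hx]
    · simp
  rw [h1, h2]
  by_cases h : A (a, b) (e, f) = 0
  · simp [h]
  · rw [hχ _ _ _ _ h, sub_self]

/-- If the state `k` moves freely from the left to the right, then the braid relation holds on
triples of states that begin with `k`. -/
lemma braidDefect_free_left (A : Matrix (ι × ι) (ι × ι) F) (k : ι) (χ : ι → F)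
    (hA : ∀ x w f, A (k, x) (w, f) = if w = x ∧ f = k then χ x else 0)
    (hχ : ∀ a b c d, A (a, b) (c, d) ≠ 0 → χ a * χ b = χ c * χ d) (a b d e f : ι) :
    braidDefect A (k, a, b) (d, e, f) = 0 := by
  rw [braidDefect, Matrix.sub_apply, left_right_left_apply, right_left_right_apply]
  simp only [hA]
  have h1 : ∑ x, ∑ y, ∑ w, (if x = a ∧ y = k then χ a else 0) * A (y, b) (w, f) *
      A (x, w) (d, e) = if f = k then A (a, b) (d, e) * (χ a * χ b) else 0 := by
    rw [Finset.sum_eq_single a, Finset.sum_eq_single k, Finset.sum_eq_single b]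
    · rw [hA]; split_ifs <;> simp_all; ring
    · intro w _ hw; rw [hA]; simp [hw]
    · simp
    · intro y _ hy; simp [hy]
    · simp
    · intro x _ hx; simp [hx]
    · simp
  have h2 : ∑ x, ∑ y, ∑ w, A (a, b) (x, y) * (if d = x ∧ w = k then χ x else 0) *
      A (w, y) (e, f) = if f = k then A (a, b) (d, e) * (χ d * χ e) else 0 := by
    rw [Finset.sum_eq_single d, Finset.sum_eq_single e, Finset.sum_eq_single k]
    · rw [hA]; split_ifs <;> simp_all; ring
    · intro w _ hw; simp [hw]
    · simp
    · intro y _ hy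
      refine Finset.sum_eq_zero fun w _ => ?_
      by_cases hw : w = k
      · rw [hw, hA]; simp [hy.symm]
      · simp [hw]
    · simp
    · intro x _ hx; simp [hx.symm]
    · simp
  rw [h1, h2]
  by_cases h : A (a, b) (d, e) = 0
  · simp [h]
  · rw [hχ _ _ _ _ h, sub_self]

/-- If the braid relation holds on all triples that contain one of the states `k`, `rv k`
in a favourable position, then it holds on all triples that contain one of them. -/
lemma IsRotationPair.braidDefect_eq_zero_of_extreme {rv : ι → ι} {μ : ι → F} {z : F}
    {B B' : Matrix (ι × ι) (ι × ι) F} (H : IsRotationPair rv μ z B B') (k : ι)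
    (h3 : ∀ a b d e f, braidDefect B (a, b, k) (d, e, f) = 0)
    (h1 : ∀ b c d e f, braidDefect B (rv k, b, c) (d, e, f) = 0)
    (g1 : ∀ b c d e f, braidDefect B' (k, b, c) (d, e, f) = 0)
    (g3 : ∀ a b d e f, braidDefect B' (a, b, rv k) (d, e, f) = 0)
    (a b c d e f : ι)
    (h : (a = k ∨ a = rv k) ∨ (b = k ∨ b = rv k) ∨ (c = k ∨ c = rv k) ∨ (d = k ∨ d = rv k) ∨
      (e = k ∨ e = rv k) ∨ (f = k ∨ f = rv k)) :
    braidDefect B (a, b, c) (d, e, f) = 0 := by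
  have R : ∀ a b c d e f, braidDefect B' (rv d, a, b) (e, f, rv c) = 0 →
      braidDefect B (a, b, c) (d, e, f) = 0 := fun a b c d e f h => by
    rw [H.braidDefect_rotate, h, mul_zero]
  have R' : ∀ a b c d e f, braidDefect B (rv d, a, b) (e, f, rv c) = 0 →
      braidDefect B' (a, b, c) (d, e, f) = 0 := fun a b c d e f h => by
    rw [H.symm.braidDefect_rotate, h, mul_zero]
  -- Two rotations bring the first state to the third position, so whichever favourable position is
  -- given, the first position is covered.
  have first : ∀ a b c d e f, (a = k ∨ a = rv k) → braidDefect B (a, b, c) (d, e, f) = 0 := by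
    rintro a b c d e f (rfl | rfl)
    · exact R _ _ _ _ _ _ (R' _ _ _ _ _ _ (h3 _ _ _ _ _))
    · exact h1 _ _ _ _ _
  have first' : ∀ a b c d e f, (a = k ∨ a = rv k) → braidDefect B' (a, b, c) (d, e, f) = 0 := by
    rintro a b c d e f (rfl | rfl)
    · exact g1 _ _ _ _ _
    · exact R' _ _ _ _ _ _ (R _ _ _ _ _ _ (g3 _ _ _ _ _))
  have hrv : ∀ x, (x = k ∨ x = rv k) → (rv x = k ∨ rv x = rv k) := by
    rintro x (rfl | rfl)
    · exact Or.inr rfl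
    · exact Or.inl (H.involutive _)
  -- The states in the places of `d`, `e`, `f`, `c`, `b` reach the first position after one to five
  -- rotations respectively, an odd number ending at `B'`.
  rcases h with h | h | h | h | h | h
  · exact first _ _ _ _ _ _ h
  · refine R _ _ _ _ _ _ (R' _ _ _ _ _ _ (R _ _ _ _ _ _ (R' _ _ _ _ _ _ (R _ _ _ _ _ _ ?_))))
    exact first' _ _ _ _ _ _ (hrv _ (hrv _ h))
  · refine R _ _ _ _ _ _ (R' _ _ _ _ _ _ (R _ _ _ _ _ _ (R' _ _ _ _ _ _ ?_)))
    exact first _ _ _ _ _ _ (hrv _ (hrv _ h))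
  · exact R _ _ _ _ _ _ (first' _ _ _ _ _ _ (hrv _ h))
  · exact R _ _ _ _ _ _ (R' _ _ _ _ _ _ (first _ _ _ _ _ _ (hrv _ h)))
  · exact R _ _ _ _ _ _ (R' _ _ _ _ _ _ (R _ _ _ _ _ _ (first' _ _ _ _ _ _ (hrv _ h))))

end Rotation

/-! ### The braiding matrix of a labelled set of states -/

section Labelled

variable {F ι : Type*} [Field F]

/-- The matrix of the amplitudes `braidEntry`. -/
def braidMatrix (lab : ι → ℤ) (γ : F) (m : ℤ → F) : Matrix (ι × ι) (ι × ι) F :=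
  Matrix.of fun p q => braidEntry γ m (lab p.1) (lab p.2) (lab q.1) (lab q.2)

/-- The matrix of the amplitudes `invEntry`. -/
def invMatrix (lab : ι → ℤ) (γ : F) (m : ℤ → F) : Matrix (ι × ι) (ι × ι) F :=
  Matrix.of fun p q => invEntry γ m (lab p.1) (lab p.2) (lab q.1) (lab q.2)

/-- The contribution of the crossing itself to the curl at the state with label `i`. -/
def curlTerm (γ : F) (m : ℤ → F) (i : ℤ) : F :=
  coupling γ i (-i) * (m (-i) / m i) - if i < 0 then γ⁻¹ - γ else 0

/-- This is the scalar identity left in `braidMatrix_mul_invMatrix` for complementary pairs, once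
the sum over intermediate pairs has been replaced by a difference of curl terms. It depends only on
the signs and relative order of `i`, `j` and `-j`. -/
lemma braidEntry_cancel_complementary (γ : F) (m : ℤ → F) (hm : ∀ i, m i ≠ 0) (hγ : γ ≠ 0)
    (i j : ℤ) :
    coupling γ i (-i) * invEntry γ m (-i) i (-j) j -
        (if i < -i then (γ⁻¹ - γ) * invEntry γ m i (-i) (-j) j else 0) +
      ((if i < -j then (γ⁻¹ - γ) * (m i / m (-j)) * coupling γ j (-j) else 0) +
        (if i < j ∧ j ≤ 0 then (γ⁻¹ - γ) * (γ⁻¹ - γ) * (m i / m j) else 0) -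
        (γ⁻¹ - γ) * (m i / m j) *
          if i ≤ -j then curlTerm γ m (-j) - curlTerm γ m i else 0) =
      if i = -j ∧ -i = j then 1 else 0 := by
  have := hm i
  have := hm (-i)
  have := hm j
  have := hm (-j)
  unfold invEntry curlTerm coupling
  rcases lt_trichotomy i (-j) with h | h | h <;> rcases lt_trichotomy i j with h' | h' | h' <;>
    rcases lt_trichotomy i 0 with h'' | h'' | h'' <;> rcases lt_trichotomy j 0 with g | g | g <;>
    first
    | (exfalso; omega)
    | (subst_vars
       simp (disch := omega) only [if_pos, if_neg, neg_neg, neg_zero, and_true,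
         if_true] at *
       field_simp
       try ring)

/-- A labelling of the states by integers, closed under `rv`, which changes the sign of labels. -/
structure IsLabelling (lab : ι → ℤ) (rv : ι → ι) : Prop where
  injective : Function.Injective lab
  lab_rv : ∀ a, lab (rv a) = -lab a

namespace IsLabelling

variable {lab : ι → ℤ} {rv : ι → ι}

lemma involutive (L : IsLabelling lab rv) (a : ι) : rv (rv a) = a :=
  L.injective (by rw [L.lab_rv, L.lab_rv, neg_neg])

lemma add_eq_zero_iff (L : IsLabelling lab rv) (a b : ι) : lab a + lab b = 0 ↔ a = rv b := by
  rw [← L.injective.eq_iff, L.lab_rv]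
  omega

variable [Fintype ι] [DecidableEq ι] (γ : F) (m : ℤ → F)

/-- The differences of the curl terms are sums of the weights `m (-i) / m i`. -/
def Telescopes (lab : ι → ℤ) (γ : F) (m : ℤ → F) : Prop :=
  ∀ a e : ι, lab a ≤ lab e →
    ∑ x, (if lab a < lab x ∧ lab x ≤ lab e then (γ⁻¹ - γ) * (m (-lab x) / m (lab x)) else 0) =
      curlTerm γ m (lab e) - curlTerm γ m (lab a)

lemma sum_braidMatrix (L : IsLabelling lab rv) (g : ι → ι → F) (a b : ι) :
    ∑ c, ∑ d, braidMatrix lab γ m (a, b) (c, d) * g c d =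
      coupling γ (lab a) (lab b) * g b a -
        (if lab a < lab b then (γ⁻¹ - γ) * g a b else 0) +
        (if a = rv b then ∑ x, (if lab a < lab x then
          (γ⁻¹ - γ) * (m (lab a) / m (lab x)) * g (rv x) x else 0) else 0) := by
  simp only [braidMatrix, Matrix.of_apply, braidEntry, add_mul, sub_mul, Finset.sum_add_distrib,
    Finset.sum_sub_distrib, L.injective.eq_iff, L.add_eq_zero_iff, ite_mul, zero_mul]
  congr 1
  · congr 1
    · rw [Finset.sum_eq_single b (fun x _ hx => by simp [hx]) (by simp)]
      simp
    · rw [Finset.sum_eq_single a (fun x _ hx => by simp [hx]) (by simp)]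
      by_cases h : lab a < lab b <;> simp [h]
  · rw [Finset.sum_comm]
    by_cases h : a = rv b
    · simp only [h, true_and, if_true]
      refine Finset.sum_congr rfl fun x _ => ?_
      rw [Finset.sum_eq_single (rv x) (fun y _ hy => by simp [hy]) (by simp)]
      simp
    · simp [h]

lemma braidMatrix_mul_invMatrix (L : IsLabelling lab rv) (hm : ∀ i, m i ≠ 0) (hγ : γ ≠ 0)
    (hT : Telescopes lab γ m) : braidMatrix lab γ m * invMatrix lab γ m = 1 := by
  ext ⟨a, b⟩ ⟨c, d⟩
  rw [Matrix.mul_apply, Fintype.sum_prod_type, sum_braidMatrix γ m L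
    (fun x y => invMatrix lab γ m (x, y) (c, d)), Matrix.one_apply]
  simp only [Prod.mk.injEq, ← L.injective.eq_iff (a := a) (b := c),
    ← L.injective.eq_iff (a := b) (b := d)]
  by_cases hab : a = rv b
  swap
  · rw [if_neg hab, add_zero]
    exact braidEntry_cancel γ m hγ _ _ _ _ (by rwa [Ne, L.add_eq_zero_iff])
  rw [if_pos hab]
  have hb : lab b = -lab a := by rw [hab, L.lab_rv, neg_neg]
  by_cases hcd : lab c + lab d = 0
  swap
  -- A complementary pair never turns into a pair that is not complementary.
  · have h0 : ∀ x y : ι, lab x + lab y = 0 → invMatrix lab γ m (x, y) (c, d) = 0 := by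
      intro x y hxy
      by_contra h
      have := invEntry_support γ m _ _ _ _ h
      dsimp only at this
      omega
    rw [h0 _ _ (by omega), h0 _ _ (by omega), if_neg (by omega : ¬(lab a = lab c ∧ lab b = lab d))]
    simp [h0, L.lab_rv]
  have hc : lab c = -lab d := by omega
  -- The intermediate pair is `(rv x, x)`. The transposition term of the inverse picks `x = c`, the
  -- diagonal term picks `x = d`, and the pair term leaves the sum of `m (-lab x) / m (lab x)`
  -- governed by `hT`.
  have hsum : ∑ x, (if lab a < lab x then (γ⁻¹ - γ) * (m (lab a) / m (lab x)) *
        invMatrix lab γ m (rv x, x) (c, d) else 0) =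
      (if lab a < -lab d then (γ⁻¹ - γ) * (m (lab a) / m (-lab d)) * coupling γ (lab d) (-lab d)
        else 0) +
      (if lab a < lab d ∧ lab d ≤ 0 then (γ⁻¹ - γ) * (γ⁻¹ - γ) * (m (lab a) / m (lab d)) else 0) -
      (γ⁻¹ - γ) * (m (lab a) / m (lab d)) *
        ∑ x, (if lab a < lab x ∧ lab x ≤ lab c then
          (γ⁻¹ - γ) * (m (-lab x) / m (lab x)) else 0) := by
    have h1 : (if lab a < -lab d then
        (γ⁻¹ - γ) * (m (lab a) / m (-lab d)) * coupling γ (lab d) (-lab d) else 0) =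
        ∑ x, if x = c then (if lab a < lab x then
          (γ⁻¹ - γ) * (m (lab a) / m (lab x)) * coupling γ (-lab x) (lab x) else 0) else 0 := by
      simp [hc]
    have h2 : (if lab a < lab d ∧ lab d ≤ 0 then
        (γ⁻¹ - γ) * (γ⁻¹ - γ) * (m (lab a) / m (lab d)) else 0) =
        ∑ x, if x = d then (if lab a < lab x ∧ lab x ≤ 0 then
          (γ⁻¹ - γ) * (γ⁻¹ - γ) * (m (lab a) / m (lab x)) else 0) else 0 := by
      simp
    rw [h1, h2, Finset.mul_sum, ← Finset.sum_add_distrib, ← Finset.sum_sub_distrib]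
    refine Finset.sum_congr rfl fun x _ => ?_
    simp only [invMatrix, Matrix.of_apply, invEntry, L.lab_rv, hc, ← L.injective.eq_iff (a := x)]
    have := hm (lab x)
    have := hm (lab d)
    grind (splits := 20)
  rw [hsum, hb, hc]
  have hT' : (∑ x, if lab a < lab x ∧ lab x ≤ -lab d then
      (γ⁻¹ - γ) * (m (-lab x) / m (lab x)) else 0) =
      if lab a ≤ -lab d then curlTerm γ m (-lab d) - curlTerm γ m (lab a) else 0 := by
    split_ifs with h
    · rw [← hc]
      exact hT a c (by omega)
    · exact Finset.sum_eq_zero fun x _ => if_neg (by omega)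
  rw [hT']
  simp only [invMatrix, Matrix.of_apply, hb, hc]
  exact braidEntry_cancel_complementary γ m hm hγ _ _

end IsLabelling

end Labelled

/-! ### The braid relation by induction on the number of states -/

section Braid

variable {F : Type*} [Field F]

lemma IsLabelling.isRotationPair {ι : Type*} [Fintype ι] [DecidableEq ι] {lab : ι → ℤ} {rv : ι → ι}
    (L : IsLabelling lab rv) (γ : F) (m : ℤ → F) (hm : ∀ i, m i ≠ 0) (hγ : γ ≠ 0)
    (hT : IsLabelling.Telescopes lab γ m) :
    IsRotationPair rv (fun a => m (lab a)) (γ⁻¹ - γ) (braidMatrix lab γ m)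
      (invMatrix lab γ m) where
  involutive := L.involutive
  ne_zero _ := hm _
  cancel := L.braidMatrix_mul_invMatrix γ m hm hγ hT
  rotate a b c d := by
    simp only [braidMatrix, invMatrix, Matrix.of_apply, L.lab_rv]
    exact braidEntry_eq_rotate γ m hm _ _ _ _
  rotate' a b c d := by
    simp only [braidMatrix, invMatrix, Matrix.of_apply, L.lab_rv]
    exact invEntry_eq_rotate γ m hm _ _ _ _
  skein := by
    ext ⟨a, b⟩ ⟨c, d⟩
    have h := braidEntry_sub_invEntry γ m (lab a) (lab b) (lab c) (lab d)
    rw [sub_eq_iff_eq_add', add_comm (lab a)] at h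
    simp only [L.add_eq_zero_iff, L.injective.eq_iff] at h
    simp only [braidMatrix, invMatrix, capCup, Matrix.of_apply, Matrix.add_apply,
      Matrix.smul_apply, Matrix.one_apply, Prod.mk.injEq, smul_eq_mul, neg_one_mul,
      ← sub_eq_add_neg]
    exact h

/-- Conservation of the charge with respect to `k`: the admissible processes permute two states or
replace one neutral pair by another. -/
lemma coupling_mul_of_support (γ : F) (hγ : γ ≠ 0) (a b c d k : ℤ)
    (h : (c = b ∧ d = a) ∨ (c = a ∧ d = b) ∨ (a + b = 0 ∧ c + d = 0)) :
    coupling γ a k * coupling γ b k = coupling γ c k * coupling γ d k := by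
  rcases h with ⟨rfl, rfl⟩ | ⟨rfl, rfl⟩ | ⟨h, h'⟩
  · exact mul_comm _ _
  · rfl
  · rw [coupling_mul_coupling_neg γ hγ a b k h, coupling_mul_coupling_neg γ hγ c d k h']

lemma sum_subtype_triple {ι : Type*} [Fintype ι] (p : ι → Prop) [DecidablePred p]
    (T : ι → ι → ι → F) (hT : ∀ x y w, T x y w ≠ 0 → p x ∧ p y ∧ p w) :
    ∑ x, ∑ y, ∑ w, T x y w = ∑ x : {x // p x}, ∑ y : {x // p x}, ∑ w : {x // p x}, T x y w := by
  have key : ∀ g : ι → F, (∀ x, g x ≠ 0 → p x) → ∑ x, g x = ∑ x : {x // p x}, g x := by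
    intro g hg
    rw [← Fintype.sum_subtype_add_sum_subtype p g, add_eq_left]
    exact Finset.sum_eq_zero fun x _ => by_contra fun h => x.2 (hg _ h)
  have h3 : ∀ x y, ∑ w, T x y w = ∑ w : {x // p x}, T x y w := fun x y =>
    key _ fun w hw => (hT x y w hw).2.2
  have h2 : ∀ x, ∑ y, ∑ w, T x y w = ∑ y : {x // p x}, ∑ w, T x y w := fun x =>
    key _ fun y hy => by
      obtain ⟨w, -, hw⟩ := Finset.exists_ne_zero_of_sum_ne_zero hy
      exact (hT x y w hw).2.1
  rw [key (fun x => ∑ y, ∑ w, T x y w)]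
  · simp only [h2]
    simp only [h3]
  · intro x hx
    obtain ⟨y, -, hy⟩ := Finset.exists_ne_zero_of_sum_ne_zero hx
    obtain ⟨w, -, hw⟩ := Finset.exists_ne_zero_of_sum_ne_zero hy
    exact (hT x y w hw).1

/-- As long as the outer states are not extreme, extreme states do not contribute to the braid
relation. -/
lemma braidDefect_restrict {ι : Type*} [Fintype ι] [DecidableEq ι] (lab : ι → ℤ) (γ : F)
    (m : ℤ → F) (K : ℤ) (hK : ∀ x, K ≤ lab x ∧ lab x ≤ -K)
    (a b c d e f : {x : ι // K < lab x ∧ lab x < -K}) :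
    braidDefect (braidMatrix lab γ m) (a.1, b.1, c.1) (d.1, e.1, f.1) =
      braidDefect (braidMatrix (fun x : {x : ι // K < lab x ∧ lab x < -K} => lab x) γ m)
        (a, b, c) (d, e, f) := by
  have ha := a.2
  have hb := b.2
  have hc := c.2
  have hd := d.2
  have he := e.2
  have hf := f.2
  simp only [braidDefect, Matrix.sub_apply, left_right_left_apply, right_left_right_apply]
  rw [sum_subtype_triple (fun x => K < lab x ∧ lab x < -K),
    sum_subtype_triple (fun x => K < lab x ∧ lab x < -K)]
  · rfl
  -- From inner states the first crossing can only create an extreme pair with the lowest label on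
  -- the left and the highest on the right. The highest then meets the inner state `c` and is forced
  -- out at `f`, a contradiction.
  · intro x y w h
    have h1 := braidEntry_support γ m _ _ _ _ (left_ne_zero_of_mul (left_ne_zero_of_mul h))
    have h2 := braidEntry_support γ m _ _ _ _ (right_ne_zero_of_mul (left_ne_zero_of_mul h))
    have h3 := braidEntry_support γ m _ _ _ _ (right_ne_zero_of_mul h)
    have := hK x
    have := hK y
    have := hK w
    dsimp only at *
    omega
  -- Mirror image: the lowest label of a created extreme pair would be forced out at `d`.
  · intro x y w h
    have h1 := braidEntry_support γ m _ _ _ _ (left_ne_zero_of_mul (left_ne_zero_of_mul h))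
    have h2 := braidEntry_support γ m _ _ _ _ (right_ne_zero_of_mul (left_ne_zero_of_mul h))
    have h3 := braidEntry_support γ m _ _ _ _ (right_ne_zero_of_mul h)
    have := hK x
    have := hK y
    have := hK w
    dsimp only at *
    omega

/-- The braid relation. -/
theorem IsLabelling.braidDefect_eq_zero {ι : Type*} [Fintype ι] [DecidableEq ι] {lab : ι → ℤ}
    {rv : ι → ι} (L : IsLabelling lab rv) (γ : F) (m : ℤ → F) (hm : ∀ i, m i ≠ 0) (hγ : γ ≠ 0)
    (hT : IsLabelling.Telescopes lab γ m) : braidDefect (braidMatrix lab γ m) = 0 := by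
  induction hn : Fintype.card ι using Nat.strong_induction_on generalizing ι with
  | _ n ih =>
  subst hn
  ext ⟨a, b, c⟩ ⟨d, e, f⟩
  obtain ⟨k, -, hk⟩ := Finset.exists_min_image Finset.univ lab ⟨a, Finset.mem_univ a⟩
  have hK : ∀ x, lab k ≤ lab x ∧ lab x ≤ -lab k := fun x => by
    have h1 := hk x (Finset.mem_univ _)
    have h2 := hk (rv x) (Finset.mem_univ _)
    rw [L.lab_rv] at h2
    omega
  have H := L.isRotationPair γ m hm hγ hT
  by_cases hex : (a = k ∨ a = rv k) ∨ (b = k ∨ b = rv k) ∨ (c = k ∨ c = rv k) ∨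
      (d = k ∨ d = rv k) ∨ (e = k ∨ e = rv k) ∨ (f = k ∨ f = rv k)
  · have hχ : ∀ i a b c d, braidMatrix lab γ m (a, b) (c, d) ≠ 0 →
        coupling γ (lab a) i * coupling γ (lab b) i =
          coupling γ (lab c) i * coupling γ (lab d) i := by
      intro i a b c d h
      refine coupling_mul_of_support γ hγ _ _ _ _ _ ?_
      have := braidEntry_support γ m _ _ _ _ h
      tauto
    have hχ' : ∀ i a b c d, invMatrix lab γ m (a, b) (c, d) ≠ 0 →
        coupling γ⁻¹ (lab a) i * coupling γ⁻¹ (lab b) i =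
          coupling γ⁻¹ (lab c) i * coupling γ⁻¹ (lab d) i := fun i a b c d h =>
      coupling_mul_of_support γ⁻¹ (inv_ne_zero hγ) _ _ _ _ _ (invEntry_support γ m _ _ _ _ h)
    have hK' : ∀ x, -lab (rv k) ≤ lab x ∧ lab x ≤ lab (rv k) := fun x => by
      rw [L.lab_rv, neg_neg]; exact hK x
    refine H.braidDefect_eq_zero_of_extreme k ?_ ?_ ?_ ?_ a b c d e f hex
    · refine braidDefect_free_right _ k (fun x => coupling γ (lab x) (lab k)) (fun x w f => ?_)
        (hχ _)
      simpa only [braidMatrix, Matrix.of_apply, L.injective.eq_iff] using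
        braidEntry_lowest_right γ m (lab k) (lab x) (lab w) (lab f) (hK x) (hK f)
    · refine braidDefect_free_left _ (rv k) (fun x => coupling γ (lab x) (lab (rv k)))
        (fun x w f => ?_) (hχ _)
      simpa only [braidMatrix, Matrix.of_apply, L.injective.eq_iff] using
        braidEntry_highest_left γ m (lab (rv k)) (lab x) (lab w) (lab f) (hK' x) (hK' f)
    · refine braidDefect_free_left _ k (fun x => coupling γ⁻¹ (lab x) (lab k))
        (fun x w f => ?_) (hχ' _)
      simpa only [invMatrix, Matrix.of_apply, L.injective.eq_iff] using
        invEntry_lowest_left γ m hm (lab k) (lab x) (lab w) (lab f) (hK x) (hK f)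
    · refine braidDefect_free_right _ (rv k) (fun x => coupling γ⁻¹ (lab x) (lab (rv k)))
        (fun x w f => ?_) (hχ' _)
      simpa only [invMatrix, Matrix.of_apply, L.injective.eq_iff] using
        invEntry_highest_right γ m hm (lab (rv k)) (lab x) (lab w) (lab f) (hK' x) (hK' f)
  · have hin : ∀ x, ¬(x = k ∨ x = rv k) → lab k < lab x ∧ lab x < -lab k := by
      intro x hx
      rw [← L.injective.eq_iff, ← L.injective.eq_iff, L.lab_rv] at hx
      have := hK x
      omega
    simp only [not_or] at hex
    simp only [not_or] at hin
    obtain ⟨ha, hb, hc, hd, he, hf⟩ := hex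
    let ι' := {x : ι // lab k < lab x ∧ lab x < -lab k}
    have L' : IsLabelling (fun x : ι' => lab x)
        (fun x => ⟨rv x, by have := x.2; rw [L.lab_rv]; omega⟩) :=
      ⟨fun x y h => Subtype.ext (L.injective h), fun x => L.lab_rv x⟩
    -- The telescoping sums run over intervals between inner labels, so the removed states
    -- contribute nothing to them.
    have hT' : IsLabelling.Telescopes (fun x : ι' => lab x) γ m := by
      intro u v huv
      rw [← hT u v huv, ← Fintype.sum_subtype_add_sum_subtype
        (fun x => lab k < lab x ∧ lab x < -lab k), left_eq_add]
      refine Finset.sum_eq_zero fun x _ => if_neg fun hx => x.2 ?_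
      have := u.2
      have := v.2
      omega
    have hcard : Fintype.card ι' < Fintype.card ι :=
      Fintype.card_subtype_lt (x := k) (by simp)
    have := ih _ hcard L' hT' rfl
    rw [braidDefect_restrict lab γ m (lab k) hK ⟨a, hin a ha⟩ ⟨b, hin b hb⟩ ⟨c, hin c hc⟩
      ⟨d, hin d hd⟩ ⟨e, hin e he⟩ ⟨f, hin f hf⟩]
    rw [this]
    rfl

end Braid

/-! ### The link model -/

section Model

variable {F ι : Type*} [Field F] [Fintype ι] [DecidableEq ι]

/-- The amplitudes of a maximum. -/
def capMatrix (rv : ι → ι) (μ : ι → F) : Matrix ι ι F :=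
  Matrix.of fun a b => if b = rv a then μ a else 0

/-- The amplitudes of a minimum. -/
def cupMatrix (rv : ι → ι) (μ : ι → F) : Matrix ι ι F :=
  Matrix.of fun a b => if b = rv a then (μ b)⁻¹ else 0

namespace IsRotationPair

variable {rv : ι → ι} {μ : ι → F} {z : F} {B B' : Matrix (ι × ι) (ι × ι) F}

lemma eq_rv_comm (H : IsRotationPair rv μ z B B') (a b : ι) : a = rv b ↔ b = rv a :=
  ⟨fun h => by rw [h, H.involutive], fun h => by rw [h, H.involutive]⟩

lemma capMatrix_mul_cupMatrix (H : IsRotationPair rv μ z B B') :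
    capMatrix rv μ * cupMatrix rv μ = 1 := by
  ext a c
  simp only [Matrix.mul_apply, capMatrix, cupMatrix, Matrix.of_apply, ite_mul, zero_mul,
    Finset.sum_ite_eq', Finset.mem_univ, if_true, H.involutive, Matrix.one_apply]
  by_cases h : c = a
  · subst h
    simp [H.ne_zero]
  · simp [h, Ne.symm h]

/-- Each sum has a single term since a cap joins complementary states; what remains is the rotation
law for `B'`. -/
lemma slideCap (H : IsRotationPair rv μ z B B') (a b c d : ι) :
    ∑ w, B (a, b) (d, w) * capMatrix rv μ w c = ∑ w, B' (b, c) (w, d) * capMatrix rv μ a w := by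
  simp only [capMatrix, Matrix.of_apply, H.eq_rv_comm c, mul_ite, mul_zero, Finset.sum_ite_eq',
    Finset.mem_univ, if_true]
  rw [H.rotate' b c (rv a) d, H.involutive]
  have := H.ne_zero a
  field_simp

lemma slideCup (H : IsRotationPair rv μ z B B') (a b c d : ι) :
    ∑ w, cupMatrix rv μ a w * B (w, b) (c, d) = ∑ w, cupMatrix rv μ w d * B' (b, w) (a, c) := by
  simp only [cupMatrix, Matrix.of_apply, H.eq_rv_comm d, ite_mul, zero_mul, Finset.sum_ite_eq',
    Finset.mem_univ, if_true]
  rw [H.rotate' b (rv d) a c, H.involutive]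
  have := H.ne_zero d
  field_simp

lemma capCup_apply (H : IsRotationPair rv μ z B B') (a b c d : ι) :
    capCup rv μ (a, b) (c, d) = capMatrix rv μ a b * cupMatrix rv μ c d := by
  simp only [capCup, capMatrix, cupMatrix, Matrix.of_apply, H.eq_rv_comm c]
  split_ifs <;> simp_all [div_eq_mul_inv]

/-- Since `z ≠ 0`, the skein relation makes the cap-cup a combination of `B`, its inverse and the
identity, so it commutes with `B`. A curl can thus be moved from the cap to the cup. -/
lemma curlCup (H : IsRotationPair rv μ z B B') (hz : z ≠ 0) {α : F}
    (h : ∀ a b, ∑ c, ∑ d, B (a, b) (c, d) * capMatrix rv μ c d = α * capMatrix rv μ a b)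
    (c d : ι) :
    ∑ a, ∑ b, cupMatrix rv μ a b * B (a, b) (c, d) = α * cupMatrix rv μ c d := by
  have hcomm : B * capCup rv μ = capCup rv μ * B := by
    have h1 : B * B' = B' * B := by rw [H.cancel, mul_eq_one_comm.1 H.cancel]
    rw [eq_sub_of_add_eq H.skein.symm] at h1
    simp only [mul_sub, sub_mul, mul_smul_comm, smul_mul_assoc, mul_add, add_mul, mul_one,
      one_mul, sub_right_inj] at h1
    exact add_right_cancel (smul_right_injective _ hz h1)
  have h1 := congrArg (fun A => A (c, rv c) (c, d)) hcomm
  simp only [Matrix.mul_apply, Fintype.sum_prod_type, H.capCup_apply, ← mul_assoc,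
    ← Finset.sum_mul, h] at h1
  simp only [mul_assoc, ← Finset.mul_sum] at h1
  rw [mul_left_comm] at h1
  exact (mul_left_cancel₀ (by simp [capMatrix, H.ne_zero]) h1).symm

lemma isLinkModel (H : IsRotationPair rv μ z B B') (hz : z ≠ 0) {α : F} (hα : α ≠ 0)
    (hbraid : braidDefect B = 0)
    (hcircle : ∑ a, ∑ b, cupMatrix rv μ a b * capMatrix rv μ a b = (α - α⁻¹) / z + 1)
    (hcurl : ∀ a b, ∑ c, ∑ d, B (a, b) (c, d) * capMatrix rv μ c d = α * capMatrix rv μ a b) :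
    IsLinkModel z α (fun e => bif e then B else B') (capMatrix rv μ) (cupMatrix rv μ) where
  cancel := by
    rintro (_ | _)
    exacts [H.symm.cancel, H.cancel]
  braid := sub_eq_zero.1 hbraid
  fusion := H.capMatrix_mul_cupMatrix
  slideCap := by
    rintro (_ | _) a b c d
    exacts [H.symm.slideCap a b c d, H.slideCap a b c d]
  slideCup := by
    rintro (_ | _) a b c d
    exacts [H.symm.slideCup a b c d, H.slideCup a b c d]
  skein a b c d := by
    have h := congrArg (fun A => A (a, b) (c, d)) H.skein
    simp only [Matrix.add_apply, Matrix.smul_apply, H.capCup_apply, Matrix.one_apply,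
      Prod.mk.injEq, smul_eq_mul] at h
    simp only [cond_true, cond_false]
    rw [h]
    ring
  circle := hcircle
  curlCap := by
    rintro (_ | _) a b
    · have h : (B' * B).mulVec (fun p => capMatrix rv μ p.1 p.2) (a, b) = capMatrix rv μ a b := by
        rw [H.symm.cancel, Matrix.one_mulVec]
      rw [← Matrix.mulVec_mulVec] at h
      simp only [Matrix.mulVec, dotProduct, Fintype.sum_prod_type, hcurl] at h
      simp only [cond_false]
      rw [eq_inv_mul_iff_mul_eq₀ hα, ← h]
      simp only [Finset.mul_sum, mul_left_comm]
    · exact hcurl a b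
  curlCup := by
    rintro (_ | _) c d
    · have h : (Matrix.vecMul (fun p => cupMatrix rv μ p.1 p.2) (B * B')) (c, d) =
          cupMatrix rv μ c d := by
        rw [H.cancel, Matrix.vecMul_one]
      rw [← Matrix.vecMul_vecMul] at h
      simp only [Matrix.vecMul, dotProduct, Fintype.sum_prod_type, H.curlCup hz hcurl] at h
      simp only [cond_false]
      rw [eq_inv_mul_iff_mul_eq₀ hα, ← h]
      simp only [Finset.mul_sum, mul_assoc]
    · exact H.curlCup hz hcurl c d

end IsRotationPair

namespace IsLabelling

variable {lab : ι → ℤ} {rv : ι → ι}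

/-- The model given by a labelling whose curls all have the value `α`. -/
theorem isLinkModel (L : IsLabelling lab rv) (γ α : F) (m : ℤ → F) (hm : ∀ i, m i ≠ 0)
    (hγ : γ ≠ 0) (hz : γ⁻¹ - γ ≠ 0) (hneg : ∃ a, lab a < 0)
    (hcurl : ∀ a, curlTerm γ m (lab a) +
      ∑ x, (if lab a < lab x then (γ⁻¹ - γ) * (m (-lab x) / m (lab x)) else 0) = α) :
    IsLinkModel (γ⁻¹ - γ) α (fun e => bif e then braidMatrix lab γ m else invMatrix lab γ m)
      (capMatrix rv fun a => m (lab a)) (cupMatrix rv fun a => m (lab a)) := by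
  -- Subtract the curl equations at `e` and at `a`: the common value `α` drops out.
  have hT : Telescopes lab γ m := by
    intro a e hae
    rw [eq_sub_of_add_eq (hcurl e), eq_sub_of_add_eq (hcurl a), sub_sub_sub_cancel_left,
      ← Finset.sum_sub_distrib]
    refine Finset.sum_congr rfl fun x _ => ?_
    grind
  obtain ⟨a₀, ha₀⟩ := hneg
  obtain ⟨k, -, hk⟩ := Finset.exists_min_image Finset.univ lab ⟨a₀, Finset.mem_univ _⟩
  have hk0 : lab k < 0 := (hk a₀ (Finset.mem_univ _)).trans_lt ha₀
  -- At the highest label `-lab k` the sum in the curl equation is empty. A negative label exists,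
  -- so `lab k ≠ 0` and the coupling there is `γ⁻¹`.
  have hα' : α = γ⁻¹ * (m (lab k) / m (-lab k)) := by
    rw [← hcurl (rv k), Finset.sum_eq_zero, L.lab_rv]
    · simp only [curlTerm, coupling, neg_neg]
      simp (disch := omega) only [if_neg, if_pos, sub_zero, add_zero]
    · intro x _
      refine if_neg ?_
      have := hk (rv x) (Finset.mem_univ _)
      rw [L.lab_rv] at *
      omega
  have hα : α ≠ 0 := by
    rw [hα']
    exact mul_ne_zero (inv_ne_zero hγ) (div_ne_zero (hm _) (hm _))
  have H := L.isRotationPair γ m hm hγ hT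
  refine H.isLinkModel hz hα (L.braidDefect_eq_zero γ m hm hγ hT) ?_ ?_
  · have h1 : ∑ a, ∑ b, cupMatrix rv (fun a => m (lab a)) a b *
        capMatrix rv (fun a => m (lab a)) a b = ∑ x, m (-lab x) / m (lab x) := by
      refine Fintype.sum_equiv ⟨rv, rv, L.involutive, L.involutive⟩ _ _ fun a => ?_
      simp only [cupMatrix, capMatrix, Matrix.of_apply, Equiv.coe_fn_mk, L.lab_rv, neg_neg]
      rw [Finset.sum_eq_single (rv a) (fun x _ hx => by simp [hx]) (by simp)]
      simp [L.lab_rv, div_eq_inv_mul]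
    have h2 : ∑ x, (if lab k < lab x then (γ⁻¹ - γ) * (m (-lab x) / m (lab x)) else 0) =
        (γ⁻¹ - γ) * ((∑ x, m (-lab x) / m (lab x)) - m (-lab k) / m (lab k)) := by
      rw [← Finset.sum_erase_eq_sub (Finset.mem_univ k), Finset.mul_sum,
        ← Finset.add_sum_erase _ _ (Finset.mem_univ k), if_neg (lt_irrefl _), zero_add]
      refine Finset.sum_congr rfl fun x hx => if_pos ?_
      refine lt_of_le_of_ne (hk x (Finset.mem_univ _)) fun h => ?_
      exact (Finset.mem_erase.1 hx).1 (L.injective h.symm)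
    -- At the lowest label the sum runs over all other states, hence contains the circle value.
    -- Combined with `α⁻¹` from the highest label this determines it.
    have h3 := hcurl k
    rw [h2] at h3
    simp only [curlTerm, coupling] at h3
    simp (disch := omega) only [if_neg, if_pos] at h3
    have h4 : α⁻¹ = γ * (m (-lab k) / m (lab k)) := by
      rw [hα']
      have := hm (lab k)
      have := hm (-lab k)
      field_simp
    rw [h1, ← sub_eq_iff_eq_add, eq_div_iff hz, h4]
    linear_combination h3
  · intro a b
    rw [L.sum_braidMatrix γ m (fun c d => capMatrix rv (fun a => m (lab a)) c d)]
    simp only [capMatrix, Matrix.of_apply, L.involutive, if_true, L.lab_rv]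
    by_cases hab : a = rv b
    · have hb : b = rv a := by rw [hab, L.involutive]
      rw [if_pos hab, if_pos hab, if_pos hb, ← hcurl a, hb, L.lab_rv, curlTerm, add_mul,
        Finset.sum_mul]
      congr 1
      · have := hm (lab a)
        by_cases h : lab a < 0
        · rw [if_pos h, if_pos (by omega)]
          field_simp
        · rw [if_neg h, if_neg (by omega), sub_zero, sub_zero]
          field_simp
      · refine Finset.sum_congr rfl fun x _ => ?_
        split_ifs <;> ring
    · have hb : b ≠ rv a := fun h => hab (by rw [h, L.involutive])
      simp [hab, hb]

end IsLabelling

end Model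

/-! ### The models of the series `B`, `C` and `D` -/

section Series

variable {F : Type*} [Field F]

/-- The label of the state `a` of `N` states. -/
def label (N : ℕ) (a : Fin N) : ℤ := 2 * (a : ℤ) - N + 1

lemma isLabelling_label (N : ℕ) : IsLabelling (label N) Fin.rev where
  injective a b h := by
    ext
    simp only [label] at h
    omega
  lab_rv a := by
    simp only [label, Fin.val_rev]
    omega

/-- The coefficients `β` are `z` times ratios of fusion weights. The correction when `a` and `b` are
complementary is the diagonal term that also occurs for noncomplementary states, here absorbed into
`β`. -/
lemma braiding_eq_braidMatrix (N : ℕ) (γ : F) (β : ℕ → ℕ → F) (m : ℤ → F)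
    (h : ∀ a b : Fin N, a < b → β a b = (γ⁻¹ - γ) * (m (label N a) / m (label N b)) -
      if a.val + b.val + 1 = N then γ⁻¹ - γ else 0) :
    braiding N γ β = braidMatrix (label N) γ m := by
  ext ⟨a, b⟩ ⟨c, d⟩
  have hβ := h a d
  simp only [braiding, braidMatrix, Matrix.of_apply, braidEntry, coupling,
    (isLabelling_label N).injective.eq_iff, Fin.lt_def] at hβ ⊢
  have h1 : label N a + label N b = 0 ↔ a.val + b.val + 1 = N := by
    simp only [label]; omega
  have h2 : label N c + label N d = 0 ↔ c.val + d.val + 1 = N := by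
    simp only [label]; omega
  have h3 : ∀ x y : Fin N, label N x < label N y ↔ x.val < y.val := by
    intro x y; simp only [label]; omega
  have h4 : a = b → (label N a = 0 ↔ a.val + b.val + 1 = N) := by
    rintro rfl; simp only [label]; omega
  simp only [h1, h2, h3, Fin.ext_iff] at h4 ⊢
  grind (splits := 20)

lemma smul_antidiagonal (N : ℕ) (t : F) (μ : ℕ → F) (m : ℤ → F)
    (h : ∀ a : Fin N, t * μ a = m (label N a)) :
    t • antidiagonal N μ = capMatrix Fin.rev fun a => m (label N a) := by
  ext a b
  have : b = Fin.rev a ↔ a.val + b.val + 1 = N := by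
    rw [Fin.ext_iff, Fin.val_rev]; omega
  simp only [Matrix.smul_apply, antidiagonal, capMatrix, Matrix.of_apply, this, smul_eq_mul,
    mul_ite, mul_zero, h]

/-- All curls have the same value if those of neighbouring states have. -/
lemma curl_eq_of_step (N : ℕ) (γ α : F) (m : ℤ → F)
    (hstep : ∀ a : ℕ, a + 1 < N → curlTerm γ m (2 * (a : ℤ) - N + 1) +
      (γ⁻¹ - γ) * (m (-(2 * (a : ℤ) - N + 3)) / m (2 * (a : ℤ) - N + 3)) =
        curlTerm γ m (2 * (a : ℤ) - N + 3))
    (htop : curlTerm γ m ((N : ℤ) - 1) = α) (a : Fin N) :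
    curlTerm γ m (label N a) + ∑ x, (if label N a < label N x then
      (γ⁻¹ - γ) * (m (-label N x) / m (label N x)) else 0) = α := by
  set g : ℕ → F := fun x => (γ⁻¹ - γ) * (m (-(2 * (x : ℤ) - N + 1)) / m (2 * (x : ℤ) - N + 1))
    with hg
  -- Induction on the distance `j` from the highest state: moving down one state adds one summand,
  -- which `hstep` absorbs.
  have key : ∀ j a : ℕ, a + j + 1 = N → curlTerm γ m (2 * (a : ℤ) - N + 1) +
      ∑ x ∈ Finset.range N, (if a < x then g x else 0) = α := by
    intro j
    induction j with
    | zero =>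
      intro a ha
      rw [Finset.sum_eq_zero, add_zero, ← htop]
      · congr 1
        omega
      · intro x hx
        rw [Finset.mem_range] at hx
        exact if_neg (by omega)
    | succ j ih =>
      intro a ha
      have h1 : ∑ x ∈ Finset.range N, (if a < x then g x else 0) =
          g (a + 1) + ∑ x ∈ Finset.range N, (if a + 1 < x then g x else 0) := by
        have : ∀ x, (if a < x then g x else 0) =
            (if x = a + 1 then g x else 0) + (if a + 1 < x then g x else 0) := by
          intro x; grind
        simp only [this, Finset.sum_add_distrib]
        rw [Finset.sum_ite_eq' _ _ g, if_pos (Finset.mem_range.2 (by omega))]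
      have h2 := hstep a (by omega)
      rw [h1, ← ih (a + 1) (by omega), ← add_assoc, hg]
      have e : 2 * ((a + 1 : ℕ) : ℤ) - N + 1 = 2 * (a : ℤ) - N + 3 := by push_cast; ring
      simp only [e]
      rw [h2]
  rw [← key (N - 1 - a) a (by omega), ← Fin.sum_univ_eq_sum_range]
  congr 1
  refine Finset.sum_congr rfl fun x _ => ?_
  simp only [label, hg]
  congr 1
  simp only [eq_iff_iff]
  omega

/-- Invertibility and the axioms of the Kauffman polynomial for matrices of the common shape. -/
theorem isKauffmanPolynomial_of_braiding (N : ℕ) (hN : 2 ≤ N) (γ α t : F) (β : ℕ → ℕ → F)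
    (μ : ℕ → F) (m : ℤ → F) (hm : ∀ i, m i ≠ 0) (hγ : γ ≠ 0) (hz : γ⁻¹ - γ ≠ 0)
    (hβ : ∀ a b : Fin N, a < b → β a b = (γ⁻¹ - γ) * (m (label N a) / m (label N b)) -
      if a.val + b.val + 1 = N then γ⁻¹ - γ else 0)
    (hμ : ∀ a : Fin N, t * μ a = m (label N a))
    (hstep : ∀ a : ℕ, a + 1 < N → curlTerm γ m (2 * (a : ℤ) - N + 1) +
      (γ⁻¹ - γ) * (m (-(2 * (a : ℤ) - N + 3)) / m (2 * (a : ℤ) - N + 3)) =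
        curlTerm γ m (2 * (a : ℤ) - N + 3))
    (htop : curlTerm γ m ((N : ℤ) - 1) = α) :
    IsUnit (braiding N γ β) ∧ IsUnit (t • antidiagonal N μ) ∧
      IsKauffmanPolynomial (γ⁻¹ - γ) α
        (vacuumExpectation (braiding N γ β) (t • antidiagonal N μ)) := by
  rw [braiding_eq_braidMatrix N γ β m hβ, smul_antidiagonal N t μ m hμ]
  have H := (isLabelling_label N).isLinkModel γ α m hm hγ hz
    ⟨⟨0, by omega⟩, by simp only [label]; omega⟩ (curl_eq_of_step N γ α m hstep htop)
  exact ⟨IsUnit.of_mul_eq_one _ (H.cancel true), IsUnit.of_mul_eq_one _ H.fusion,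
    H.isKauffmanPolynomial⟩

/-- The fusion amplitudes of the orthogonal series, in terms of labels. -/
def orthogonalWeight (s t : F) (i : ℤ) : F :=
  t * if i < 0 then s ^ (-i - 1) else if i = 0 then 1 else s ^ (1 - i)

/-- The fusion amplitudes of the symplectic series, in terms of labels. -/
def symplecticWeight (I s t : F) (i : ℤ) : F :=
  t * if i < 0 then -I * s ^ (-(i / 2)) else I * s ^ (-(i / 2) - 1)

lemma orthogonalWeight_ne_zero (s t : F) (hs : s ≠ 0) (ht : t ≠ 0) (i : ℤ) :
    orthogonalWeight s t i ≠ 0 := by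
  unfold orthogonalWeight
  split_ifs <;> simp [hs, ht, zpow_ne_zero]

lemma symplecticWeight_ne_zero (I s t : F) (hI : I ≠ 0) (hs : s ≠ 0) (ht : t ≠ 0) (i : ℤ) :
    symplecticWeight I s t i ≠ 0 := by
  unfold symplecticWeight
  split_ifs <;> simp [hI, hs, ht, zpow_ne_zero]

lemma orthogonalWeight_div (s t : F) (hs : s ≠ 0) (ht : t ≠ 0) (i j : ℤ) :
    orthogonalWeight s t i / orthogonalWeight s t j =
      s ^ ((if i < 0 then -i - 1 else if i = 0 then 0 else 1 - i) -
        (if j < 0 then -j - 1 else if j = 0 then 0 else 1 - j)) := by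
  rw [zpow_sub₀ hs]
  unfold orthogonalWeight
  split_ifs <;> field_simp

lemma orthogonal_curlTerm (s t : F) (hs : s ≠ 0) (ht : t ≠ 0) (i : ℤ) :
    curlTerm (s ^ 2)⁻¹ (orthogonalWeight s t) i =
      if i < 0 then s ^ (2 * i + 4) - (s ^ 2 - (s ^ 2)⁻¹) else s ^ (2 * i) := by
  unfold curlTerm coupling
  rw [orthogonalWeight_div s t hs ht, inv_inv]
  rcases lt_trichotomy i 0 with h | h | h
  · simp (disch := omega) only [if_pos, if_neg]
    rw [← zpow_natCast, ← zpow_add₀ hs]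
    congr 2
    push_cast
    ring
  · subst h
    simp
  · simp (disch := omega) only [if_pos, if_neg, sub_zero]
    rw [← zpow_natCast, ← zpow_add₀ hs]
    congr 1
    push_cast
    ring

/-- Both orthogonal series are covered at once: even labels occur for `B_n`, odd ones for `D_n`.
Neighbouring labels differ by 2. -/
lemma orthogonal_step (s t : F) (hs : s ≠ 0) (ht : t ≠ 0) (i : ℤ) :
    curlTerm (s ^ 2)⁻¹ (orthogonalWeight s t) i + ((s ^ 2)⁻¹⁻¹ - (s ^ 2)⁻¹) *
      (orthogonalWeight s t (-(i + 2)) / orthogonalWeight s t (i + 2)) =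
      curlTerm (s ^ 2)⁻¹ (orthogonalWeight s t) (i + 2) := by
  rw [orthogonal_curlTerm s t hs ht, orthogonal_curlTerm s t hs ht,
    orthogonalWeight_div s t hs ht, inv_inv]
  have e : ∀ k : ℤ, s ^ (2 * i + k) = s ^ (2 * i) * s ^ k := fun k => zpow_add₀ hs _ _
  rcases lt_trichotomy (i + 2) 0 with h | h | h
  · simp (disch := omega) only [if_pos, if_neg]
    rw [show 1 - -(i + 2) - (-(i + 2) - 1) = 2 * i + 6 by ring,
      show 2 * (i + 2) + 4 = 2 * i + 8 by ring, e, e, e]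
    field_simp
    ring
  · obtain rfl : i = -2 := by omega
    norm_num
  -- Near the middle, `i = -1` is the step of `D_n` that skips the label 0, while `i = 0` leaves the
  -- middle state of `B_n`.
  · rcases lt_trichotomy i 0 with h' | h' | h'
    · obtain rfl : i = -1 := by omega
      norm_num
    · subst h'
      norm_num
      field_simp
      ring
    · simp (disch := omega) only [if_pos, if_neg]
      rw [show -(-(i + 2)) - 1 - (1 - (i + 2)) = 2 * i + 2 by ring,
        show 2 * (i + 2) = 2 * i + 4 by ring, e, e]
      field_simp
      ring

/-- The minus sign comes from the ratio of `-I` and `I`; it is the source of the sign of `α` for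
`C_n`. -/
lemma symplecticWeight_neg_div (I s t : F) (hI : I ≠ 0) (hs : s ≠ 0) (ht : t ≠ 0) (j : ℤ) :
    symplecticWeight I s t (-(2 * j + 1)) / symplecticWeight I s t (2 * j + 1) =
      if j < 0 then -s ^ (2 * j) else -s ^ (2 * j + 2) := by
  unfold symplecticWeight
  rw [show -(2 * j + 1) / 2 = -j - 1 by omega, show (2 * j + 1) / 2 = j by omega]
  by_cases h : j < 0
  · simp (disch := omega) only [if_pos, if_neg]
    rw [show -(-j - 1) - 1 = j by ring, two_mul, zpow_add₀ hs, zpow_neg]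
    have := zpow_ne_zero j hs
    field_simp
  · simp (disch := omega) only [if_pos, if_neg]
    rw [show 2 * j + 2 = (j + 1) + (j + 1) by ring, show -(-j - 1) = j + 1 by ring,
      show -j - 1 = -(j + 1) by ring, zpow_add₀ hs (j + 1), zpow_neg]
    have := zpow_ne_zero (j + 1) hs
    field_simp

lemma symplectic_curlTerm (I s t : F) (hI : I ≠ 0) (hs : s ≠ 0) (ht : t ≠ 0) (j : ℤ) :
    curlTerm s⁻¹ (symplecticWeight I s t) (2 * j + 1) =
      if j < 0 then -s ^ (2 * j + 1) - (s - s⁻¹) else -s ^ (2 * j + 3) := by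
  unfold curlTerm coupling
  rw [symplecticWeight_neg_div I s t hI hs ht, inv_inv]
  have e : ∀ k : ℤ, s ^ (2 * j + k) = s ^ (2 * j) * s ^ k := fun k => zpow_add₀ hs _ _
  by_cases h : j < 0
  · simp (disch := omega) only [if_pos, if_neg]
    rw [e, zpow_one]
    ring
  · simp (disch := omega) only [if_pos, if_neg]
    rw [e, e]
    field_simp
    ring

lemma symplectic_step (I s t : F) (hI : I ≠ 0) (hs : s ≠ 0) (ht : t ≠ 0) (j : ℤ) :
    curlTerm s⁻¹ (symplecticWeight I s t) (2 * j + 1) + (s⁻¹⁻¹ - s⁻¹) *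
      (symplecticWeight I s t (-(2 * (j + 1) + 1)) / symplecticWeight I s t (2 * (j + 1) + 1)) =
      curlTerm s⁻¹ (symplecticWeight I s t) (2 * (j + 1) + 1) := by
  rw [symplectic_curlTerm I s t hI hs ht, symplectic_curlTerm I s t hI hs ht,
    symplecticWeight_neg_div I s t hI hs ht, inv_inv]
  have e : ∀ k : ℤ, s ^ (2 * j + k) = s ^ (2 * j) * s ^ k := fun k => zpow_add₀ hs _ _
  rw [show 2 * (j + 1) + 1 = 2 * j + 3 by ring, show 2 * (j + 1) + 2 = 2 * j + 4 by ring,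
    show 2 * (j + 1) + 3 = 2 * j + 5 by ring, show 2 * (j + 1) = 2 * j + 2 by ring]
  rcases lt_trichotomy j (-1) with h | h | h
  · simp (disch := omega) only [if_pos]
    rw [e, e, e]
    field_simp
    ring
  · subst h
    norm_num
    field_simp
    ring
  · simp (disch := omega) only [if_neg]
    rw [e, e, e]
    field_simp
    ring

lemma betaB_eq (n : ℕ) (s t : F) (hs : s ≠ 0) (ht : t ≠ 0) (a b : Fin (2 * n + 1)) (hab : a < b) :
    betaB n s a b = ((s ^ 2)⁻¹⁻¹ - (s ^ 2)⁻¹) * (orthogonalWeight s t (label (2 * n + 1) a) /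
      orthogonalWeight s t (label (2 * n + 1) b)) -
      if a.val + b.val + 1 = 2 * n + 1 then (s ^ 2)⁻¹⁻¹ - (s ^ 2)⁻¹ else 0 := by
  rw [orthogonalWeight_div s t hs ht, inv_inv]
  obtain ⟨a, ha⟩ := a
  obtain ⟨b, hb⟩ := b
  simp only [Fin.mk_lt_mk] at hab
  simp only [betaB, label]
  push_cast
  rcases lt_trichotomy a n with h | h | h <;> rcases lt_trichotomy b n with h' | h' | h' <;>
    try (exfalso; omega)
  · rw [if_pos (mul_pos_of_neg_of_neg (by omega) (by omega))]
    simp (disch := omega) only [if_pos, if_neg, sub_zero]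
    congr 2
    ring
  · subst h'
    rw [if_neg (by simp), if_pos (by simp)]
    simp (disch := omega) only [if_pos, if_neg, sub_zero]
    congr 2
    ring
  · have hx : ((a : ℤ) - n) * ((b : ℤ) - n) < 0 := mul_neg_of_neg_of_pos (by omega) (by omega)
    rw [if_neg hx.not_gt, if_neg hx.ne]
    simp (disch := omega) only [if_pos, if_neg]
    rw [show -2 * ((a : ℤ) - b + 1) = -(2 * (a : ℤ) - (2 * n + 1) + 1) - 1 -
      (1 - (2 * (b : ℤ) - (2 * n + 1) + 1)) by ring]
    by_cases hc : a + b = 2 * n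
    · rw [if_pos hc, if_pos (by omega)]
      ring
    · rw [if_neg hc, if_neg (by omega)]
      ring
  · subst h
    rw [if_neg (by simp), if_pos (by simp)]
    simp (disch := omega) only [if_pos, if_neg, sub_zero]
    congr 2
    ring
  · rw [if_pos (mul_pos (by omega) (by omega))]
    simp (disch := omega) only [if_neg, sub_zero]
    congr 2
    ring

lemma betaD_eq (n : ℕ) (s t : F) (hs : s ≠ 0) (ht : t ≠ 0) (a b : Fin (2 * n)) (hab : a < b) :
    betaD n s a b = ((s ^ 2)⁻¹⁻¹ - (s ^ 2)⁻¹) * (orthogonalWeight s t (label (2 * n) a) /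
      orthogonalWeight s t (label (2 * n) b)) -
      if a.val + b.val + 1 = 2 * n then (s ^ 2)⁻¹⁻¹ - (s ^ 2)⁻¹ else 0 := by
  rw [orthogonalWeight_div s t hs ht, inv_inv]
  obtain ⟨a, ha⟩ := a
  obtain ⟨b, hb⟩ := b
  simp only [Fin.mk_lt_mk] at hab
  simp only [betaD, label]
  push_cast
  rcases lt_or_ge a n with h | h <;> rcases lt_or_ge b n with h' | h' <;>
    try (exfalso; omega)
  · rw [if_pos (mul_pos_of_neg_of_neg (by omega) (by omega))]
    simp (disch := omega) only [if_pos, if_neg, sub_zero]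
    congr 2
    ring
  · have hx : (2 * (a : ℤ) - 2 * n + 1) * (2 * (b : ℤ) - 2 * n + 1) < 0 :=
      mul_neg_of_neg_of_pos (by omega) (by omega)
    rw [if_neg hx.not_gt]
    simp (disch := omega) only [if_pos, if_neg]
    rw [show -2 * ((a : ℤ) - b + 1) = -(2 * (a : ℤ) - 2 * n + 1) - 1 -
      (1 - (2 * (b : ℤ) - 2 * n + 1)) by ring]
    split_ifs <;> ring
  · rw [if_pos (mul_pos (by omega) (by omega))]
    simp (disch := omega) only [if_neg, sub_zero]
    congr 2
    ring

lemma betaC_eq (n : ℕ) (I s t : F) (hI : I ≠ 0) (hs : s ≠ 0) (ht : t ≠ 0) (a b : Fin (2 * n))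
    (hab : a < b) :
    betaC n s a b = (s⁻¹⁻¹ - s⁻¹) * (symplecticWeight I s t (label (2 * n) a) /
      symplecticWeight I s t (label (2 * n) b)) -
      if a.val + b.val + 1 = 2 * n then s⁻¹⁻¹ - s⁻¹ else 0 := by
  rw [inv_inv]
  obtain ⟨a, ha⟩ := a
  obtain ⟨b, hb⟩ := b
  simp only [Fin.mk_lt_mk] at hab
  simp only [betaC, label, symplecticWeight]
  push_cast
  rw [show (2 * (a : ℤ) - 2 * n + 1) / 2 = a - n by omega,
    show (2 * (b : ℤ) - 2 * n + 1) / 2 = b - n by omega]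
  rcases lt_or_ge a n with h | h <;> rcases lt_or_ge b n with h' | h' <;>
    try (exfalso; omega)
  · rw [if_pos (mul_pos_of_neg_of_neg (by omega) (by omega))]
    simp (disch := omega) only [if_pos, if_neg, sub_zero]
    rw [show -((a : ℤ) - b) = -(a - n) - -(b - n) by ring, zpow_sub₀ hs]
    field_simp
  · have hx : (2 * (a : ℤ) - 2 * n + 1) * (2 * (b : ℤ) - 2 * n + 1) < 0 :=
      mul_neg_of_neg_of_pos (by omega) (by omega)
    rw [if_neg hx.not_gt]
    simp (disch := omega) only [if_pos, if_neg]
    rw [show -((a : ℤ) - b - 1) = -(a - n) - (-(b - n) - 1) by ring, zpow_sub₀ hs]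
    have := zpow_ne_zero (-((b : ℤ) - n) - 1) hs
    split_ifs <;> field_simp <;> ring
  · rw [if_pos (mul_pos (by omega) (by omega))]
    simp (disch := omega) only [if_neg, sub_zero]
    rw [show -((a : ℤ) - b) = (-(a - n) - 1) - (-(b - n) - 1) by ring, zpow_sub₀ hs]
    field_simp

theorem isKauffmanPolynomial_B (n : ℕ) (hn : 1 ≤ n) (s t : F) (hs : s ≠ 0) (ht : t ≠ 0)
    (hz : s ^ 2 - (s ^ 2)⁻¹ ≠ 0) :
    IsUnit (braidingB n s) ∧ IsUnit (t • fusionB n s) ∧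
      IsKauffmanPolynomial (s ^ 2 - (s ^ 2)⁻¹) ((s ^ 4) ^ n)
        (vacuumExpectation (braidingB n s) (t • fusionB n s)) := by
  have h := isKauffmanPolynomial_of_braiding (2 * n + 1) (by omega) (s ^ 2)⁻¹ ((s ^ 4) ^ n) t
    (betaB n s) (fun a => if a < n then s ^ (2 * ((n : ℤ) - a) - 1)
      else if a = n then 1 else s ^ (2 * ((n : ℤ) - a) + 1)) (orthogonalWeight s t)
    (orthogonalWeight_ne_zero s t hs ht) (inv_ne_zero (pow_ne_zero 2 hs)) (by rwa [inv_inv])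
    (betaB_eq n s t hs ht) ?_ ?_ ?_
  · rwa [inv_inv] at h
  · rintro ⟨a, ha⟩
    simp only [orthogonalWeight, label]
    push_cast
    rcases lt_trichotomy a n with h | h | h <;> simp (disch := omega) only [if_pos, if_neg]
    · congr 2
      ring
    · congr 2
      ring
  · intro a _
    have := orthogonal_step s t hs ht (2 * (a : ℤ) - (2 * n + 1 : ℕ) + 1)
    rwa [show (2 * (a : ℤ) - (2 * n + 1 : ℕ) + 1) + 2 = 2 * (a : ℤ) - (2 * n + 1 : ℕ) + 3 by
      ring] at this
  -- The highest label is `2 * n`, whose curl is `s ^ (4 * n)`.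
  · rw [orthogonal_curlTerm s t hs ht, if_neg (by push_cast; omega), ← pow_mul, ← zpow_natCast]
    congr 1
    push_cast
    ring

theorem isKauffmanPolynomial_C (n : ℕ) (hn : 1 ≤ n) (I s t : F) (hI : I ≠ 0) (hs : s ≠ 0)
    (ht : t ≠ 0) (hz : s - s⁻¹ ≠ 0) :
    IsUnit (braidingC n s) ∧ IsUnit (t • fusionC n I s) ∧
      IsKauffmanPolynomial (s - s⁻¹) (-s ^ (2 * n + 1))
        (vacuumExpectation (braidingC n s) (t • fusionC n I s)) := by
  have h := isKauffmanPolynomial_of_braiding (2 * n) (by omega) s⁻¹ (-s ^ (2 * n + 1)) t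
    (betaC n s) (fun a => if a < n then -I * s ^ ((n : ℤ) - a) else I * s ^ ((n : ℤ) - a - 1))
    (symplecticWeight I s t) (symplecticWeight_ne_zero I s t hI hs ht) (inv_ne_zero hs)
    (by rwa [inv_inv]) (betaC_eq n I s t hI hs ht) ?_ ?_ ?_
  · rwa [inv_inv] at h
  · rintro ⟨a, ha⟩
    simp only [symplecticWeight, label]
    push_cast
    rw [show (2 * (a : ℤ) - 2 * n + 1) / 2 = a - n by omega, neg_sub]
    rcases lt_or_ge a n with h | h <;> simp (disch := omega) only [if_pos, if_neg]
  · intro a _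
    have := symplectic_step I s t hI hs ht ((a : ℤ) - n)
    rwa [show 2 * ((a : ℤ) - n) + 1 = 2 * (a : ℤ) - (2 * n : ℕ) + 1 by push_cast; ring,
      show 2 * ((a : ℤ) - n + 1) + 1 = 2 * (a : ℤ) - (2 * n : ℕ) + 3 by push_cast; ring] at this
  -- The highest label `2 * n - 1` corresponds to `j = n - 1`, so the exponent is `2 * j + 3 = 2 * n
  -- + 1`.
  · rw [show ((2 * n : ℕ) : ℤ) - 1 = 2 * ((n : ℤ) - 1) + 1 by push_cast; ring,
      symplectic_curlTerm I s t hI hs ht, if_neg (by omega), ← zpow_natCast]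
    congr 2
    push_cast
    ring

theorem isKauffmanPolynomial_D (n : ℕ) (hn : 1 ≤ n) (s t : F) (hs : s ≠ 0) (ht : t ≠ 0)
    (hz : s ^ 2 - (s ^ 2)⁻¹ ≠ 0) :
    IsUnit (braidingD n s) ∧ IsUnit (t • fusionD n s) ∧
      IsKauffmanPolynomial (s ^ 2 - (s ^ 2)⁻¹) ((s ^ 2) ^ (2 * n - 1))
        (vacuumExpectation (braidingD n s) (t • fusionD n s)) := by
  have h := isKauffmanPolynomial_of_braiding (2 * n) (by omega) (s ^ 2)⁻¹ ((s ^ 2) ^ (2 * n - 1)) t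
    (betaD n s) (fun a => if a < n then s ^ (2 * ((n : ℤ) - a - 1)) else s ^ (2 * ((n : ℤ) - a)))
    (orthogonalWeight s t) (orthogonalWeight_ne_zero s t hs ht) (inv_ne_zero (pow_ne_zero 2 hs))
    (by rwa [inv_inv]) (betaD_eq n s t hs ht) ?_ ?_ ?_
  · rwa [inv_inv] at h
  · rintro ⟨a, ha⟩
    simp only [orthogonalWeight, label]
    push_cast
    rcases lt_or_ge a n with h | h <;> simp (disch := omega) only [if_pos, if_neg]
    · congr 2
      ring
    · congr 2
      ring
  · intro a _
    have := orthogonal_step s t hs ht (2 * (a : ℤ) - (2 * n : ℕ) + 1)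
    rwa [show (2 * (a : ℤ) - (2 * n : ℕ) + 1) + 2 = 2 * (a : ℤ) - (2 * n : ℕ) + 3 by
      ring] at this
  · rw [orthogonal_curlTerm s t hs ht, if_neg (by push_cast; omega), ← pow_mul, ← zpow_natCast]
    congr 1
    push_cast [Nat.cast_sub (show 1 ≤ 2 * n by omega)]
    ring

end Series

end LinkSum

theorem mainTheorem1 {F : Type*} [Field F] (n : ℕ) (hn : 1 ≤ n) (q s : F) (hs : s ^ 4 = q)
    (hq : q ≠ 0) (t : F) (ht : t ≠ 0) :
    (q ≠ 1 →
      IsUnit (LinkSum.braidingB n s) ∧ IsUnit (t • LinkSum.fusionB n s) ∧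
      LinkSum.IsKauffmanPolynomial (s ^ 2 - (s ^ 2)⁻¹) (q ^ n)
        (LinkSum.vacuumExpectation (LinkSum.braidingB n s) (t • LinkSum.fusionB n s))) ∧
    (∀ I : F, I ^ 2 = -1 → s ^ 2 ≠ 1 →
      IsUnit (LinkSum.braidingC n s) ∧ IsUnit (t • LinkSum.fusionC n I s) ∧
      LinkSum.IsKauffmanPolynomial (s - s⁻¹) (-s ^ (2 * n + 1))
        (LinkSum.vacuumExpectation (LinkSum.braidingC n s) (t • LinkSum.fusionC n I s))) ∧
    (q ≠ 1 →
      IsUnit (LinkSum.braidingD n s) ∧ IsUnit (t • LinkSum.fusionD n s) ∧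
      LinkSum.IsKauffmanPolynomial (s ^ 2 - (s ^ 2)⁻¹) ((s ^ 2) ^ (2 * n - 1))
        (LinkSum.vacuumExpectation (LinkSum.braidingD n s) (t • LinkSum.fusionD n s))) := by
  subst hs
  have hs : s ≠ 0 := fun h => hq (by simp [h])
  -- If `z` vanished, `s ^ 2` would be its own inverse, forcing `q = s ^ 4 = 1`.
  have hz : s ^ 4 ≠ 1 → s ^ 2 - (s ^ 2)⁻¹ ≠ 0 := by
    intro h h0
    have h1 := mul_inv_cancel₀ (pow_ne_zero 2 hs)
    rw [← sub_eq_zero.1 h0] at h1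
    exact h (by rw [← h1]; ring)
  refine ⟨fun h => LinkSum.isKauffmanPolynomial_B n hn s t hs ht (hz h), fun I hI h => ?_,
    fun h => LinkSum.isKauffmanPolynomial_D n hn s t hs ht (hz h)⟩
  refine LinkSum.isKauffmanPolynomial_C n hn I s t ?_ hs ht ?_
  · rintro rfl
    simp at hI
  · intro h0
    have h1 := mul_inv_cancel₀ hs
    rw [← sub_eq_zero.1 h0] at h1
    exact h (by rw [← h1]; ring)
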